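/- Let $\mathcal P$ be a countable set with a norm map $N:\mathcal P\to\mathbb Z_{>1}$, and let $\mathcal M$ be the free abelian monoid generated by $\mathcal P$. Write $\mathfrak m=\sum_{\mathfrak p\in\mathcal P}n_{\mathfrak p}(\mathfrak m)\,\mathfrak p$ for $\mathfrak m\in\mathcal M$, where $n_{\mathfrak p}(\mathfrak m)\in\mathbb Z_{\ge 0}$ and $n_{\mathfrak p}(\mathfrak m)=0$ for all but finitely many $\mathfrak p$, and extend $N$ to $\mathcal M$ by $N(\mathfrak m)=\prod_{\mathfrak p}N(\mathfrak p)^{n_{\mathfrak p}(\mathfrak m)}$. Let $X=\mathbb Q$ or $X=\{q^z: z\in\mathbb Z\}$ for some integer $q\ge 2$, and assume $N(\mathfrak m)\in X$ for all $\mathfrak m\in\mathcal M$. Assume that there are $\kappa>0$ and $0\le\theta<1$ such that $$\#\{\mathfrak m\in\mathcal M : N(\mathfrak m)\le x\}=\kappa x+O(x^\theta)\qquad\text{for sufficiently large } x\in X.$$ Let $k\ge 1$ be an integer. Let $\omega_k(\mathfrak m)$ be the number of $\mathfrak p\in\mathcal P$ with $n_{\mathfrak p}(\mathfrak m)=k$.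 Call $\mathfrak m$ $k$-full if every $\mathfrak p$ with $n_{\mathfrak p}(\mathfrak m)\neq 0$ satisfies $n_{\mathfrak p}(\mathfrak m)\ge k$ (so every element of $\mathcal M$ is $1$-full), and let $\mathcal N_k(x)$ be the set of $k$-full $\mathfrak m\in\mathcal M$ with $N(\mathfrak m)\le x$. Then for every $a\in\mathbb R$, $$\lim_{\substack{x\to\infty\\ x\in X}}\frac{1}{|\mathcal N_k(x)|}\left|\left\{\mathfrak m\in\mathcal N_k(x): N(\mathfrak m)\ge 3,\ \frac{\omega_k(\mathfrak m)-\log\log N(\mathfrak m)}{\sqrt{\log\log N(\mathfrak m)}}\le a\right\}\right|=\Phi(a),$$ where $\Phi(a)=\frac{1}{\sqrt{2\pi}}\int_{-\infty}^{a}e^{-u^2/2}\,du$. -/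

import Mathlib

open Filter Topology Asymptotics

namespace ErdosKacMonoid

/-- The free abelian monoid generated by `P`, written additively: an element `m` is the finitely
supported family of its multiplicities `m p`. -/
abbrev FreeMonoidOn (P : Type*) : Type _ := P →₀ ℕ

/-- The norm of an element of the free abelian monoid, extending multiplicatively a norm map `N`
given on the generators: the product over `p` of `N p ^ (m p)`. -/
def monoidNorm {P : Type*} (N : P → ℕ) (m : FreeMonoidOn P) : ℕ :=
  m.prod fun p n => N p ^ n

/-- The sets in which the counting variable `x` may range: all of `ℚ`, or the integral powers
of an integer `q ≥ 2`. -/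
def IsScale (X : Set ℚ) : Prop :=
  X = Set.univ ∨ ∃ q : ℕ, 2 ≤ q ∧ X = Set.range fun z : ℤ => (q : ℚ) ^ z

/-- The filter expressing that `x` tends to infinity through elements of `X`. -/
def atTopIn (X : Set ℚ) : Filter ℚ :=
  atTop ⊓ 𝓟 X

/-- The number of elements of norm at most `x`, for `x` in `X`, is `κ x + O(x ^ θ)` for some
`κ > 0` and some `0 ≤ θ < 1`.  (Were there infinitely many such elements for some `x`, then so for
all larger ones, `Set.ncard` would be `0` there, and the condition would fail since `κ > 0`.) -/
def CountingCondition {P : Type*} (N : P → ℕ) (X : Set ℚ) : Prop :=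
  ∃ κ θ : ℝ, 0 < κ ∧ 0 ≤ θ ∧ θ < 1 ∧
    (fun x : ℚ => ({m : FreeMonoidOn P | (monoidNorm N m : ℚ) ≤ x}.ncard : ℝ) - κ * (x : ℝ))
      =O[atTopIn X] fun x : ℚ => (x : ℝ) ^ θ

/-- Every generator that occurs in `m` occurs with multiplicity at least `k`.  For `k = 1` this
holds for all `m`. -/
def IsFull {P : Type*} (k : ℕ) (m : FreeMonoidOn P) : Prop :=
  ∀ p : P, m p ≠ 0 → k ≤ m p

/-- The `k`-full elements of norm at most `x`. -/
def fullUpTo {P : Type*} (N : P → ℕ) (k : ℕ) (x : ℚ) : Set (FreeMonoidOn P) :=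
  {m | IsFull k m ∧ (monoidNorm N m : ℚ) ≤ x}

/-- For `k ≥ 1`, the number of generators that occur in `m` with multiplicity exactly `k`. -/
def omegaExact {P : Type*} (k : ℕ) (m : FreeMonoidOn P) : ℕ :=
  (m.support.filter fun p => m p = k).card

/-- The distribution function of the standard normal law. -/
noncomputable def Phi (a : ℝ) : ℝ :=
  1 / Real.sqrt (2 * Real.pi) * ∫ u in Set.Iic a, Real.exp (-u ^ 2 / 2)

end ErdosKacMonoid

namespace ErdosKacMonoid

/-! ### The norm and its counting function -/

section Norm

variable {P : Type*} {N : P → ℕ}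

/-! The proof reduces `k`-full elements to all elements, and treats the latter by characteristic
functions. A `k`-full `m` is uniquely `k • n + e` with every nonzero multiplicity of `e` strictly
between `k` and `2k` (`exists_eq_nsmul_add`, `nsmul_add_injective`). For fixed `e`, the condition
`N(m) ≤ x` says `N(n) ≤ (x / N(e))^(1/k)`, so the fibre over `e` has `O((x / N(e))^(1/k))` elements.
The series of `N(e)^(-1/k)` converges, because nonzero multiplicities of `e` are at least `k + 1`
(`Regular.summable_remainder`). By dominated convergence it suffices to find the limit `Φ(a)` on
each fibre (`Regular.tendsto_ncard_full_div`).

On a fibre with `N(n) ≤ y`, put `L = log log y` and `z = y^(1/L²)`. Then `ω_k(k • n + e)` differs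
from the number of generators of norm at most `z` occurring in `n` only through generators in `e`
(boundedly many), generators with multiplicity at least 2 in `n` (boundedly many on average), and
generators of norm above `z` (`o(√L)` on average by Mertens' theorem).

The truncated count `ω` has average of `exp(iτω) = (1 + u)^ω`, where `τ = s/√L` and `u = exp(iτ) -
1`. Expanding binomially to order about `2L` uses only the frequency with which a set `D` of
generators occurs in `n`, which is the product of the `1/N(p)` up to `O(y^(θ-1))`, uniformly in `D`.
As `z^(2L)` is a vanishing power of `y`, the average is close to the product of the `1 + u/N(p)`,
hence to `exp(uS)` with `S` the sum of `1/N(p)` over `N(p) ≤ z` (`Regular.tendsto_charAverage_sub`).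
Mertens' theorem gives `S = L + o(√L)`, so after centring the limit is `exp(-s²/2)`, and Lévy's
continuity theorem concludes. Mertens' theorem itself (`Regular.recipSum_sub_isLittleO`) follows
from linear growth alone, through Euler products. -/

lemma monoidNorm_zero : monoidNorm N 0 = 1 := by simp [monoidNorm]

lemma monoidNorm_add (m n : FreeMonoidOn P) :
    monoidNorm N (m + n) = monoidNorm N m * monoidNorm N n := by
  classical
  exact Finsupp.prod_add_index' (by simp) (by intros; rw [pow_add])

lemma monoidNorm_single (p : P) (j : ℕ) : monoidNorm N (Finsupp.single p j) = N p ^ j := by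
  simp [monoidNorm]

lemma monoidNorm_nsmul (k : ℕ) (m : FreeMonoidOn P) :
    monoidNorm N (k • m) = monoidNorm N m ^ k := by
  induction k with
  | zero => simp [monoidNorm_zero]
  | succ k ih => rw [succ_nsmul, monoidNorm_add, ih, pow_succ]

lemma monoidNorm_pos (hN : ∀ p, 1 < N p) (m : FreeMonoidOn P) : 0 < monoidNorm N m :=
  Finset.prod_pos fun p _ => pow_pos (by linarith [hN p]) _

lemma one_le_monoidNorm (hN : ∀ p, 1 < N p) (m : FreeMonoidOn P) :
    (1 : ℝ) ≤ monoidNorm N m := by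
  exact_mod_cast monoidNorm_pos hN m

lemma monoidNorm_sum {ι : Type*} (s : Finset ι) (f : ι → FreeMonoidOn P) :
    monoidNorm N (∑ i ∈ s, f i) = ∏ i ∈ s, monoidNorm N (f i) := by
  classical
  induction s using Finset.induction_on with
  | empty => simp [monoidNorm_zero]
  | insert i s hi ih => rw [Finset.sum_insert hi, Finset.prod_insert hi, monoidNorm_add, ih]

/-- The elements of norm at most `t`, as a finset (empty if there are infinitely many). -/
noncomputable def below (N : P → ℕ) (t : ℝ) : Finset (FreeMonoidOn P) :=
  open scoped Classical in
  if h : {m : FreeMonoidOn P | (monoidNorm N m : ℝ) ≤ t}.Finite then h.toFinset else ∅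

end Norm

/-- A norm on a free abelian monoid with linear growth of the counting function and power saving
in the level of distribution. -/
structure Regular {P : Type*} (N : P → ℕ) : Prop where
  one_lt : ∀ p, 1 < N p
  finite : ∀ t : ℝ, {m : FreeMonoidOn P | (monoidNorm N m : ℝ) ≤ t}.Finite
  lower : ∃ c : ℝ, 0 < c ∧ ∀ t : ℝ, 1 ≤ t → c * t ≤ (below N t).card
  upper : ∃ C : ℝ, 0 < C ∧ ∀ t : ℝ, 0 ≤ t → (below N t).card ≤ C * t
  level : ∃ C θ : ℝ, 0 < C ∧ 0 ≤ θ ∧ θ < 1 ∧ ∀ t : ℝ, 1 ≤ t → ∀ d : FreeMonoidOn P,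
    |({n : FreeMonoidOn P | n ∈ below N t ∧ d ≤ n}.ncard : ℝ)
      - (below N t).card / (monoidNorm N d : ℝ)| ≤ C * t ^ θ

/-! ### From counting along `X` to counting in a real variable -/

section Scale

/-- Norms are integers lying in `X`, so they cannot tell a real `t` from the largest integer, or
power of `q`, not exceeding it; this replacement costs at most a bounded factor `B`. -/
lemma IsScale.round {X : Set ℚ} (hX : IsScale X) :
    ∃ B : ℝ, 1 ≤ B ∧ ∀ t : ℝ, 1 ≤ t → ∃ x ∈ X, 1 ≤ x ∧ (x : ℝ) ≤ t ∧ t ≤ B * x ∧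
      ∀ n : ℕ, (n : ℚ) ∈ X → ((n : ℝ) ≤ t ↔ (n : ℚ) ≤ x) := by
  rcases hX with rfl | ⟨q, hq, rfl⟩
  · refine ⟨2, by norm_num, fun t ht => ⟨⌊t⌋₊, Set.mem_univ _, ?_, ?_, ?_, ?_⟩⟩
    · exact_mod_cast (Nat.one_le_floor_iff t).2 ht
    · exact_mod_cast Nat.floor_le (by linarith)
    · have h1 := Nat.lt_floor_add_one t
      have h2 : (1 : ℝ) ≤ ⌊t⌋₊ := by exact_mod_cast (Nat.one_le_floor_iff t).2 ht
      push_cast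
      linarith
    · intro n _
      rw [Nat.cast_le, Nat.le_floor_iff (by linarith)]
  · have hq1 : (1 : ℝ) < q := by exact_mod_cast hq
    have hq0 : (1 : ℚ) < q := by exact_mod_cast hq
    refine ⟨q, hq1.le, fun t ht => ⟨(q : ℚ) ^ Int.log q t, ⟨_, rfl⟩, ?_, ?_, ?_, ?_⟩⟩
    · refine one_le_zpow₀ hq0.le ?_
      rw [← Int.zpow_le_iff_le_log (by omega) (by linarith)]
      simpa using ht
    · push_cast
      exact Int.zpow_log_le_self (by omega) (by linarith)
    · have := (Int.lt_zpow_succ_log_self (b := q) (by omega) t).le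
      rw [zpow_add_one₀ (by positivity)] at this
      push_cast
      linarith
    · rintro n ⟨z, hz⟩
      have hz' : (n : ℝ) = (q : ℝ) ^ z := by
        have := congrArg (fun r : ℚ => (r : ℝ)) hz
        push_cast at this
        exact this.symm
      simp only at hz
      rw [hz', ← hz, Int.zpow_le_iff_le_log (by omega) (by linarith)]
      exact (zpow_le_zpow_iff_right₀ hq0).symm

lemma IsScale.div_mem {X : Set ℚ} (hX : IsScale X) {x y : ℚ} (hx : x ∈ X) (hy : y ∈ X) :
    x / y ∈ X := by
  rcases hX with rfl | ⟨q, hq, rfl⟩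
  · trivial
  · obtain ⟨a, rfl⟩ := hx
    obtain ⟨b, rfl⟩ := hy
    exact ⟨a - b, zpow_sub₀ (by positivity) _ _⟩

lemma mem_below_iff {P : Type*} {N : P → ℕ} {t : ℝ}
    (h : {m : FreeMonoidOn P | (monoidNorm N m : ℝ) ≤ t}.Finite) (m : FreeMonoidOn P) :
    m ∈ below N t ↔ (monoidNorm N m : ℝ) ≤ t := by
  simp [below, h]

lemma eventually_rpow_le {C ε θ : ℝ} (hε : 0 < ε) (hθ : θ < 1) :
    ∀ᶠ t : ℝ in atTop, C * t ^ θ ≤ ε * t := by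
  have h := (tendsto_rpow_neg_atTop (sub_pos.2 hθ)).const_mul C
  rw [mul_zero] at h
  filter_upwards [h.eventually_le_const hε, eventually_gt_atTop 0] with t ht ht0
  calc C * t ^ θ = C * t ^ (-(1 - θ)) * t := by
        rw [mul_assoc, ← Real.rpow_add_one ht0.ne']; ring_nf
    _ ≤ ε * t := by gcongr

/-- The counting condition holds, with a finite count, for all positive `x ∈ X`. -/
lemma CountingCondition.bound {P : Type*} {N : P → ℕ} (hN : ∀ p, 1 < N p)
    {X : Set ℚ} (hX : IsScale X) (hcount : CountingCondition N X) :
    (∀ x : ℚ, {m : FreeMonoidOn P | (monoidNorm N m : ℚ) ≤ x}.Finite) ∧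
    ∃ κ θ C : ℝ, 0 < κ ∧ 0 ≤ θ ∧ θ < 1 ∧ 0 < C ∧ ∀ x ∈ X, 0 < x →
      |({m : FreeMonoidOn P | (monoidNorm N m : ℚ) ≤ x}.ncard : ℝ) - κ * x| ≤ C * (x : ℝ) ^ θ := by
  obtain ⟨κ, θ, hκ, hθ0, hθ1, hO⟩ := hcount
  obtain ⟨B, hB1, hB⟩ := hX.round
  obtain ⟨C, hC, hO⟩ := hO.exists_pos
  rw [IsBigOWith, atTopIn, eventually_inf_principal, eventually_atTop] at hO
  obtain ⟨x₀, hx₀⟩ := hO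
  have hx1 : ∀ x ∈ X, max x₀ 1 ≤ x →
      |({m : FreeMonoidOn P | (monoidNorm N m : ℚ) ≤ x}.ncard : ℝ) - κ * x|
        ≤ C * (x : ℝ) ^ θ := by
    intro x hx hxx
    have h1 : (1 : ℝ) ≤ x := by exact_mod_cast (le_max_right _ _).trans hxx
    have := hx₀ x ((le_max_left _ _).trans hxx) hx
    rwa [Real.norm_eq_abs, Real.norm_eq_abs,
      abs_of_nonneg (Real.rpow_nonneg (by linarith) _)] at this
  have hlo : ∀ᶠ t : ℝ in atTop, C * t ^ θ ≤ κ / 2 * t := eventually_rpow_le (by positivity) hθ1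
  obtain ⟨t₀, ht₀⟩ := eventually_atTop.1 hlo
  have hlarge : ∀ r : ℚ, ∃ x ∈ X, r ≤ x := by
    intro r
    obtain ⟨x, hx, h1, -, h3, -⟩ := hB (max 1 (B * r)) (le_max_left _ _)
    refine ⟨x, hx, ?_⟩
    have : B * r ≤ B * x := (le_max_right _ _).trans h3
    exact_mod_cast le_of_mul_le_mul_left this (by linarith)
  have hfin : ∀ x : ℚ, {m : FreeMonoidOn P | (monoidNorm N m : ℚ) ≤ x}.Finite := by
    intro r
    obtain ⟨r', hr'⟩ := exists_rat_gt t₀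
    obtain ⟨x, hx, hrx⟩ := hlarge (max (max r r') (max x₀ 1))
    have h2 := hx1 x hx ((le_max_right _ _).trans hrx)
    have h3 : r' ≤ x := (le_max_right _ _).trans ((le_max_left _ _).trans hrx)
    have h4 := ht₀ x (hr'.le.trans (by exact_mod_cast h3))
    have h5 : (1 : ℝ) ≤ x := by
      exact_mod_cast (le_max_right _ _).trans ((le_max_right _ _).trans hrx)
    -- Finiteness comes from the convention that `Set.ncard` of an infinite set is 0: the main term
    -- forces a positive count at arbitrarily large `x`.
    have h6 : (0 : ℝ) < ({m : FreeMonoidOn P | (monoidNorm N m : ℚ) ≤ x}.ncard : ℝ) := by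
      have := (abs_le.1 h2).1
      nlinarith
    refine (Set.finite_of_ncard_pos (by exact_mod_cast h6)).subset fun m hm => ?_
    exact le_trans hm ((le_max_left _ _).trans ((le_max_left _ _).trans hrx))
  refine ⟨hfin, ?_⟩
  set x₁ := max x₀ 1
  set G := {m : FreeMonoidOn P | (monoidNorm N m : ℚ) ≤ x₁}.ncard
  have hx₁ : (1 : ℝ) ≤ x₁ := by exact_mod_cast le_max_right x₀ 1
  -- The constant covers three ranges: `C` is for `x ≥ x₁`; `G + κ * x₁` bounds count and main term
  -- for `1 ≤ x < x₁`; `κ` suffices for `x < 1`, where the count is 0 and `x ≤ x ^ θ`. Values below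
  -- 1 matter because `x / N(d)` is used later.
  refine ⟨κ, θ, C + κ + G + κ * x₁, hκ, hθ0, hθ1, by positivity, fun x hx hx0 => ?_⟩
  have hx0' : (0 : ℝ) < x := by exact_mod_cast hx0
  have hp : 0 ≤ (x : ℝ) ^ θ := Real.rpow_nonneg hx0'.le _
  have hG0 : (0 : ℝ) ≤ G := Nat.cast_nonneg _
  have hκx : 0 ≤ κ * x₁ := by positivity
  rcases lt_or_ge x 1 with h1 | h1
  · have hem : {m : FreeMonoidOn P | (monoidNorm N m : ℚ) ≤ x} = ∅ := by
      refine Set.eq_empty_of_forall_notMem fun m hm => ?_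
      have : (1 : ℚ) ≤ monoidNorm N m := by exact_mod_cast monoidNorm_pos hN m
      have hm' : (monoidNorm N m : ℚ) ≤ x := hm
      linarith
    have hx1' : (x : ℝ) ≤ 1 := by exact_mod_cast h1.le
    have : (x : ℝ) ≤ (x : ℝ) ^ θ := by
      simpa using Real.rpow_le_rpow_of_exponent_ge hx0' hx1' hθ1.le
    rw [hem, Set.ncard_empty, Nat.cast_zero, zero_sub, abs_neg, abs_of_pos (by positivity)]
    nlinarith
  · rcases le_or_gt x₁ x with h2 | h2
    · refine (hx1 x hx h2).trans ?_
      gcongr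
      linarith
    · have hG : ({m : FreeMonoidOn P | (monoidNorm N m : ℚ) ≤ x}.ncard : ℝ) ≤ G := by
        exact_mod_cast Set.ncard_le_ncard (fun m hm => le_trans hm h2.le) (hfin x₁)
      have h3 : (1 : ℝ) ≤ (x : ℝ) ^ θ := Real.one_le_rpow (by exact_mod_cast h1) hθ0
      have h4 : (x : ℝ) ≤ x₁ := by exact_mod_cast h2.le
      have h5 : κ * x ≤ κ * x₁ := by gcongr
      have h6 : (0 : ℝ) ≤ ({m : FreeMonoidOn P | (monoidNorm N m : ℚ) ≤ x}.ncard : ℝ) :=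
        Nat.cast_nonneg _
      have h7 : 0 ≤ κ * x := by positivity
      rw [abs_le]
      constructor <;> nlinarith

/-- The level of distribution is automatic in a free monoid: elements above `d` are the translates
`d + m`, so they are counted by the same function at `x / N(d)`, which stays in `X`. -/
lemma CountingCondition.regular {P : Type*} {N : P → ℕ} (hN : ∀ p, 1 < N p)
    {X : Set ℚ} (hX : IsScale X) (hNX : ∀ m : FreeMonoidOn P, (monoidNorm N m : ℚ) ∈ X)
    (hcount : CountingCondition N X) : Regular N := by
  obtain ⟨hfin, κ, θ, C, hκ, hθ0, hθ1, hC, hbd⟩ := hcount.bound hN hX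
  obtain ⟨B, hB1, hB⟩ := hX.round
  have hfinR : ∀ t : ℝ, {m : FreeMonoidOn P | (monoidNorm N m : ℝ) ≤ t}.Finite := by
    intro t
    obtain ⟨r, hr⟩ := exists_rat_gt t
    refine (hfin r).subset fun m hm => ?_
    have : (monoidNorm N m : ℝ) ≤ r := le_trans hm hr.le
    exact_mod_cast this
  have hmem := fun t => mem_below_iff (hfinR t)
  have hcard : ∀ t : ℝ, ∀ x : ℚ, (∀ n : ℕ, (n : ℚ) ∈ X → ((n : ℝ) ≤ t ↔ (n : ℚ) ≤ x)) →
      (below N t).card = {m : FreeMonoidOn P | (monoidNorm N m : ℚ) ≤ x}.ncard := by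
    intro t x h
    rw [← Set.ncard_coe_finset]
    congr 1
    ext m
    simp [hmem, h _ (hNX m)]
  have hpos : ∀ t : ℝ, 1 ≤ t → 1 ≤ (below N t).card := by
    intro t ht
    refine Finset.card_pos.2 ⟨0, ?_⟩
    simpa [hmem, monoidNorm_zero] using ht
  refine ⟨hN, hfinR, ?_, ⟨κ + C, by positivity, fun t ht => ?_⟩,
    ⟨2 * C, θ, by positivity, hθ0, hθ1, fun t ht d => ?_⟩⟩
  · have hlo : ∀ᶠ t : ℝ in atTop, C * t ^ θ ≤ κ / 2 * t := eventually_rpow_le (by positivity) hθ1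
    obtain ⟨t₀, ht₀⟩ := eventually_atTop.1 hlo
    set t₁ := max t₀ 1
    have ht₁ : 0 < t₁ := lt_of_lt_of_le one_pos (le_max_right _ _)
    -- For large `x` half the main term survives the error; for small `x` the element 0 is already
    -- counted, whence `1 / t₁`. Rounding costs the factor `B`.
    refine ⟨min (κ / 2) (1 / t₁) / B, by positivity, fun t ht => ?_⟩
    obtain ⟨x, hx, h1, h2, h3, h4⟩ := hB t ht
    have hx1 : (1 : ℝ) ≤ x := by exact_mod_cast h1
    have key : min (κ / 2) (1 / t₁) * x ≤ (below N t).card := by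
      rcases le_or_gt t₀ (x : ℝ) with h | h
      · have := (abs_le.1 (hbd x hx (by linarith))).1
        rw [← hcard t x h4] at this
        have := ht₀ x h
        have : min (κ / 2) (1 / t₁) * x ≤ κ / 2 * x := by gcongr; exact min_le_left _ _
        linarith
      · calc min (κ / 2) (1 / t₁) * x ≤ 1 / t₁ * t₁ := by
              gcongr
              · exact min_le_right _ _
              · exact h.le.trans (le_max_left _ _)
          _ = 1 := by field_simp
          _ ≤ _ := by exact_mod_cast hpos t ht
    calc min (κ / 2) (1 / t₁) / B * t ≤ min (κ / 2) (1 / t₁) / B * (B * x) := by gcongr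
      _ = min (κ / 2) (1 / t₁) * x := by field_simp
      _ ≤ _ := key
  · rcases lt_or_ge t 1 with h | h
    · have : below N t = ∅ := by
        refine Finset.eq_empty_of_forall_notMem fun m hm => ?_
        rw [hmem] at hm
        linarith [one_le_monoidNorm hN m]
      rw [this]
      simp only [Finset.card_empty, Nat.cast_zero]
      positivity
    · obtain ⟨x, hx, h1, h2, h3, h4⟩ := hB t h
      have hx1 : (1 : ℝ) ≤ x := by exact_mod_cast h1
      have := (abs_le.1 (hbd x hx (by linarith))).2
      rw [← hcard t x h4] at this
      have h5 : (x : ℝ) ^ θ ≤ x := by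
        simpa using Real.rpow_le_rpow_of_exponent_le hx1 hθ1.le
      nlinarith
  · obtain ⟨x, hx, h1, h2, h3, h4⟩ := hB t ht
    have hx1 : (1 : ℝ) ≤ x := by exact_mod_cast h1
    have hd := one_le_monoidNorm hN d
    have hd' : (0 : ℚ) < monoidNorm N d := by exact_mod_cast monoidNorm_pos hN d
    have hcount2 : {n : FreeMonoidOn P | n ∈ below N t ∧ d ≤ n}.ncard =
        {m : FreeMonoidOn P | (monoidNorm N m : ℚ) ≤ x / monoidNorm N d}.ncard := by
      have : {n : FreeMonoidOn P | n ∈ below N t ∧ d ≤ n} = (fun n => d + n) ''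
          {m : FreeMonoidOn P | (monoidNorm N m : ℚ) ≤ x / monoidNorm N d} := by
        ext n
        simp only [hmem, Set.mem_ofPred_eq, Set.mem_image, h4 _ (hNX n)]
        constructor
        · rintro ⟨hn, hdn⟩
          obtain ⟨m, rfl⟩ := exists_add_of_le hdn
          refine ⟨m, ?_, rfl⟩
          rw [monoidNorm_add] at hn
          rw [le_div_iff₀ hd', mul_comm]
          exact_mod_cast hn
        · rintro ⟨m, hm, rfl⟩
          rw [le_div_iff₀ hd', mul_comm] at hm
          refine ⟨?_, le_self_add⟩
          rw [monoidNorm_add]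
          exact_mod_cast hm
      rw [this, Set.ncard_image_of_injective _ (add_right_injective d)]
    have e1 := hbd x hx (by linarith)
    have e2 := hbd (x / monoidNorm N d) (hX.div_mem hx (hNX d)) (by positivity)
    rw [← hcard t x h4] at e1
    rw [← hcount2] at e2
    push_cast at e2
    have hxt : (x : ℝ) ^ θ ≤ t ^ θ := by gcongr
    have hxd : ((x : ℝ) / monoidNorm N d) ^ θ ≤ t ^ θ := by
      refine Real.rpow_le_rpow (by positivity) ((div_le_self (by linarith) hd).trans h2) hθ0
    have e3 : |((below N t).card : ℝ) / monoidNorm N d - κ * (x / monoidNorm N d)| ≤ C * t ^ θ := by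
      rw [show ((below N t).card : ℝ) / monoidNorm N d - κ * (x / monoidNorm N d)
        = ((below N t).card - κ * x) / monoidNorm N d by ring, abs_div,
        abs_of_pos (show (0 : ℝ) < monoidNorm N d by linarith)]
      refine (div_le_self (abs_nonneg _) hd).trans (e1.trans ?_)
      gcongr
    have e2' := e2.trans (mul_le_mul_of_nonneg_left hxd hC.le)
    rw [abs_le] at e2' e3 ⊢
    constructor <;> linarith [e2'.1, e2'.2, e3.1, e3.2]

end Scale

/-! ### Euler products and Mertens' theorem -/

section Mertens

variable {P : Type*} {N : P → ℕ}

lemma Regular.mem_below (h : Regular N) {t : ℝ} {m : FreeMonoidOn P} :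
    m ∈ below N t ↔ (monoidNorm N m : ℝ) ≤ t :=
  mem_below_iff (h.finite t) m

/-- The generators of norm at most `t`, as a finset (empty if there are infinitely many). -/
noncomputable def gensBelow (N : P → ℕ) (t : ℝ) : Finset P :=
  open scoped Classical in
  if h : {p : P | (N p : ℝ) ≤ t}.Finite then h.toFinset else ∅

lemma Regular.finite_gens (h : Regular N) (t : ℝ) : {p : P | (N p : ℝ) ≤ t}.Finite := by
  refine Set.Finite.of_finite_image (f := fun p => Finsupp.single p 1) ((h.finite t).subset ?_)
    (Function.Injective.injOn (Finsupp.single_left_injective one_ne_zero))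
  rintro _ ⟨p, hp, rfl⟩
  simpa [monoidNorm_single] using hp

lemma Regular.mem_gensBelow (h : Regular N) {t : ℝ} {p : P} :
    p ∈ gensBelow N t ↔ (N p : ℝ) ≤ t := by
  simp [gensBelow, h.finite_gens t]

lemma Regular.card_gensBelow_le (h : Regular N) (t : ℝ) :
    (gensBelow N t).card ≤ (below N t).card := by
  refine Finset.card_le_card_of_injOn (fun p => Finsupp.single p 1) (fun p hp => ?_)
    (Function.Injective.injOn (Finsupp.single_left_injective one_ne_zero))
  have := h.mem_gensBelow.1 hp
  simpa [h.mem_below, monoidNorm_single] using this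

/-- The sum of the reciprocal norms of the generators of norm at most `t`. -/
noncomputable def recipSum (N : P → ℕ) (t : ℝ) : ℝ := ∑ p ∈ gensBelow N t, (N p : ℝ)⁻¹

/-- The finite Euler product: expanding the product chooses a multiplicity for each generator. -/
lemma sum_finsupp_prod (T : Finset P) (J : P → Finset ℕ) (f : P → ℕ → ℝ) :
    ∑ e ∈ T.finsupp J, ∏ p ∈ T, f p (e p) = ∏ p ∈ T, ∑ j ∈ J p, f p j := by
  classical
  rw [Finset.prod_sum, Finset.finsupp, Finset.sum_map]
  refine Finset.sum_congr rfl fun x _ => ?_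
  rw [← Finset.prod_attach T]
  refine Finset.prod_congr rfl fun p _ => ?_
  simp

lemma monoidNorm_rpow (s : ℝ) {m : FreeMonoidOn P} {T : Finset P} (hT : m.support ⊆ T) :
    (monoidNorm N m : ℝ) ^ s = ∏ p ∈ T, ((N p : ℝ) ^ (m p)) ^ s := by
  rw [monoidNorm, Finsupp.prod_of_support_subset m hT _ (by simp)]
  push_cast
  exact (Real.finsetProd_rpow _ _ (fun p _ => by positivity) s).symm

lemma le_monoidNorm_of_mem_support (hN : ∀ p, 1 < N p) {m : FreeMonoidOn P} {p : P}
    (hp : p ∈ m.support) : N p ≤ monoidNorm N m := by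
  refine Nat.le_of_dvd (monoidNorm_pos hN m) ?_
  exact (dvd_pow_self _ (Finsupp.mem_support_iff.1 hp)).trans
    (Finset.dvd_prod_of_mem (fun p => N p ^ m p) hp)

lemma multiplicity_lt_monoidNorm (hN : ∀ p, 1 < N p) (m : FreeMonoidOn P) (p : P) :
    m p < monoidNorm N m := by
  by_cases hp : m p = 0
  · rw [hp]; exact monoidNorm_pos hN m
  · refine lt_of_lt_of_le (Nat.lt_pow_self (hN p)) (Nat.le_of_dvd (monoidNorm_pos hN m) ?_)
    exact Finset.dvd_prod_of_mem (fun p => N p ^ m p) (Finsupp.mem_support_iff.2 hp)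

/-- Upper bound for the zeta function of the monoid to the right of its pole. -/
lemma Regular.zeta_le (h : Regular N) : ∃ C : ℝ, 0 < C ∧ ∀ δ : ℝ, 0 < δ → δ ≤ 1 →
    ∀ T : Finset (FreeMonoidOn P), ∑ m ∈ T, (monoidNorm N m : ℝ) ^ (-(1 + δ)) ≤ C / δ := by
  obtain ⟨C, hC, hup⟩ := h.upper
  refine ⟨4 * C, by positivity, fun δ hδ hδ1 T => ?_⟩
  -- Dyadic blocks: about `2^j` elements of norm about `2^j` contribute `O(r^j)` with `r = 2^(-δ)`,
  -- and Bernoulli's inequality gives `1 - r ≥ δ / 2`.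
  set l : FreeMonoidOn P → ℕ := fun m => Nat.log 2 (monoidNorm N m)
  set J := T.sup l + 1
  have hl : ∀ m ∈ T, l m ∈ Finset.range J := fun m hm =>
    Finset.mem_range.2 (Nat.lt_succ_of_le (Finset.le_sup hm))
  set r : ℝ := (2 : ℝ) ^ (-δ)
  have hr0 : 0 < r := by positivity
  have hr : r ≤ 1 - δ / 2 := by
    have := rpow_one_add_le_one_add_mul_self (s := -1 / 2) (by norm_num) hδ.le hδ1
    have e : r = (1 + -1 / 2 : ℝ) ^ δ := by
      rw [show (1 + -1 / 2 : ℝ) = 2⁻¹ by norm_num, Real.inv_rpow (by norm_num),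
        ← Real.rpow_neg (by norm_num)]
    rw [e]
    linarith
  have hblock : ∀ j, ∑ m ∈ T with l m = j, (monoidNorm N m : ℝ) ^ (-(1 + δ)) ≤
      2 * C * r ^ j := by
    intro j
    have h1 : ∀ m ∈ T.filter (fun m => l m = j), (monoidNorm N m : ℝ) ^ (-(1 + δ)) ≤
        ((2 : ℝ) ^ j) ^ (-(1 + δ)) := by
      intro m hm
      refine Real.rpow_le_rpow_of_nonpos (by positivity) ?_ (by linarith)
      have := Nat.pow_log_le_self 2 (monoidNorm_pos h.one_lt m).ne'
      rw [show Nat.log 2 (monoidNorm N m) = j from (Finset.mem_filter.1 hm).2] at this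
      exact_mod_cast this
    have h2 : ((T.filter (fun m => l m = j)).card : ℝ) ≤ C * 2 ^ (j + 1) := by
      refine le_trans ?_ (hup (2 ^ (j + 1)) (by positivity))
      have : T.filter (fun m => l m = j) ⊆ below N (2 ^ (j + 1)) := by
        intro m hm
        rw [h.mem_below]
        have := (Nat.lt_pow_succ_log_self (b := 2) (by norm_num) (monoidNorm N m)).le
        rw [show Nat.log 2 (monoidNorm N m) = j from (Finset.mem_filter.1 hm).2] at this
        exact_mod_cast this
      exact_mod_cast Finset.card_le_card this
    calc ∑ m ∈ T with l m = j, (monoidNorm N m : ℝ) ^ (-(1 + δ))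
        ≤ (T.filter (fun m => l m = j)).card • ((2 : ℝ) ^ j) ^ (-(1 + δ)) :=
          Finset.sum_le_card_nsmul _ _ _ h1
      _ ≤ (C * 2 ^ (j + 1)) * ((2 : ℝ) ^ j) ^ (-(1 + δ)) := by
          rw [nsmul_eq_mul]; gcongr
      _ = 2 * C * r ^ j := by
          have : ((2 : ℝ) ^ j) ^ (-(1 + δ)) = ((2 : ℝ) ^ j)⁻¹ * r ^ j := by
            rw [neg_add, Real.rpow_add (by positivity), Real.rpow_neg_one,
              ← Real.rpow_natCast_mul (by norm_num), mul_comm (j : ℝ),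
              Real.rpow_mul_natCast (by norm_num)]
          rw [this, pow_succ]
          field_simp
  calc ∑ m ∈ T, (monoidNorm N m : ℝ) ^ (-(1 + δ))
      = ∑ j ∈ Finset.range J, ∑ m ∈ T with l m = j, (monoidNorm N m : ℝ) ^ (-(1 + δ)) :=
        (Finset.sum_fiberwise_of_maps_to hl _).symm
    _ ≤ ∑ j ∈ Finset.range J, 2 * C * r ^ j := Finset.sum_le_sum fun j _ => hblock j
    _ = 2 * C * ∑ j ∈ Finset.range J, r ^ j := by rw [Finset.mul_sum]
    _ ≤ 2 * C * (1 - r)⁻¹ := by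
        gcongr
        have hr1 : r < 1 := by linarith
        rw [← tsum_geometric_of_lt_one hr0.le hr1]
        exact (summable_geometric_of_lt_one hr0.le hr1).sum_le_tsum _ (fun _ _ => by positivity)
    _ ≤ 2 * C * (δ / 2)⁻¹ := by
        gcongr
        linarith
    _ = 4 * C / δ := by field_simp; norm_num

lemma Regular.sum_gens_rpow_le (h : Regular N) {δ : ℝ} (hδ : 0 < δ) (hδ1 : δ ≤ 1) :
    ∃ K : ℝ, 0 < K ∧ ∀ T : Finset P, ∑ p ∈ T, (N p : ℝ) ^ (-(1 + δ)) ≤ K := by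
  obtain ⟨C, hC, hz⟩ := h.zeta_le
  refine ⟨C / δ, by positivity, fun T => ?_⟩
  have := hz δ hδ hδ1
    (T.map ⟨fun p => Finsupp.single p 1, Finsupp.single_left_injective one_ne_zero⟩)
  simpa [monoidNorm_single] using this

lemma Regular.sum_gens_sq_le (h : Regular N) :
    ∃ K : ℝ, 0 < K ∧ ∀ T : Finset P, ∑ p ∈ T, ((N p : ℝ)⁻¹) ^ 2 ≤ K := by
  obtain ⟨K, hK, hb⟩ := h.sum_gens_rpow_le one_pos le_rfl
  refine ⟨K, hK, fun T => le_of_eq_of_le (Finset.sum_congr rfl fun p _ => ?_) (hb T)⟩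
  rw [show (-(1 + 1) : ℝ) = -((2 : ℕ) : ℝ) by norm_num, Real.rpow_neg (by positivity),
    Real.rpow_natCast, inv_pow]

/-- Lower bound for the sum of reciprocals over the monoid. -/
lemma Regular.le_sum_inv (h : Regular N) : ∃ c : ℝ, 0 < c ∧ ∀ x : ℝ, 1 ≤ x →
    c * Real.log x ≤ ∑ m ∈ below N x, (monoidNorm N m : ℝ)⁻¹ := by
  obtain ⟨c, hc, hlo⟩ := h.lower
  refine ⟨c / 2, by positivity, fun x hx => ?_⟩
  set V := ⌊x⌋₊
  -- Partial summation: `1 / N(m)` is at least a telescoping sum over `n ≥ N(m)`, and exchanging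
  -- sums turns the left side into the counting function at the integers.
  have htel : ∀ a : ℕ, 1 ≤ a → ∀ b : ℕ, a ≤ b + 1 →
      ∑ n ∈ Finset.Icc a b, ((n : ℝ) * (n + 1))⁻¹ = (a : ℝ)⁻¹ - ((b : ℝ) + 1)⁻¹ := by
    intro a ha b
    induction b with
    | zero =>
      intro hab
      obtain rfl : a = 1 := by omega
      simp
    | succ b ih =>
      intro hab
      rcases Nat.lt_or_ge (b + 1) a with h1 | h1
      · obtain rfl : a = b + 2 := by omega
        simp; ring
      · rw [Finset.sum_Icc_succ_top h1, ih h1]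
        push_cast
        field_simp
        ring
  have h1 : ∀ m ∈ below N x, ∑ n ∈ Finset.Icc (monoidNorm N m) V, ((n : ℝ) * (n + 1))⁻¹ ≤
      (monoidNorm N m : ℝ)⁻¹ := by
    intro m hm
    have : monoidNorm N m ≤ V := Nat.le_floor (h.mem_below.1 hm)
    rw [htel _ (monoidNorm_pos h.one_lt m) _ (by omega)]
    have : (0 : ℝ) ≤ ((V : ℝ) + 1)⁻¹ := by positivity
    linarith
  have h2 : ∀ n ∈ Finset.Icc 1 V, c / 2 * (n : ℝ)⁻¹ ≤
      ∑ m ∈ below N n, ((n : ℝ) * (n + 1))⁻¹ := by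
    intro n hn
    have hn1 : (1 : ℝ) ≤ n := by exact_mod_cast (Finset.mem_Icc.1 hn).1
    rw [Finset.sum_const, nsmul_eq_mul]
    calc c / 2 * (n : ℝ)⁻¹ ≤ (c * n) * ((n : ℝ) * (n + 1))⁻¹ := by
          rw [← sub_nonneg]
          have : (c * n) * ((n : ℝ) * (n + 1))⁻¹ - c / 2 * (n : ℝ)⁻¹
              = c * (n - 1) / (2 * n * (n + 1)) := by
            field_simp; ring
          rw [this]
          have : (0 : ℝ) ≤ n - 1 := by linarith
          positivity
      _ ≤ _ := by gcongr; exact hlo n hn1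
  calc c / 2 * Real.log x ≤ c / 2 * Real.log ((V + 1 : ℕ)) := by
        gcongr
        push_cast
        exact (Nat.lt_floor_add_one x).le
    _ ≤ c / 2 * ∑ n ∈ Finset.Icc 1 V, (n : ℝ)⁻¹ := by
        gcongr
        have := log_add_one_le_harmonic V
        rw [harmonic_eq_sum_Icc] at this
        push_cast at this ⊢
        exact this
    _ = ∑ n ∈ Finset.Icc 1 V, c / 2 * (n : ℝ)⁻¹ := by rw [Finset.mul_sum]
    _ ≤ ∑ n ∈ Finset.Icc 1 V, ∑ m ∈ below N n, ((n : ℝ) * (n + 1))⁻¹ := Finset.sum_le_sum h2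
    _ = ∑ m ∈ below N x, ∑ n ∈ Finset.Icc (monoidNorm N m) V, ((n : ℝ) * (n + 1))⁻¹ := by
        refine Finset.sum_comm' fun n m => ?_
        simp only [Finset.mem_Icc, h.mem_below, Nat.cast_le]
        constructor
        · rintro ⟨⟨h3, h4⟩, h5⟩
          refine ⟨⟨h5, h4⟩, ?_⟩
          calc (monoidNorm N m : ℝ) ≤ V := by exact_mod_cast h5.trans h4
            _ ≤ x := Nat.floor_le (by linarith)
        · rintro ⟨⟨h3, h4⟩, h5⟩
          exact ⟨⟨(monoidNorm_pos h.one_lt m).trans_le h3, h4⟩, h3⟩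
    _ ≤ _ := Finset.sum_le_sum h1

/-- Each element of norm at most `x` appears in the Euler product over generators of norm at most
`x`. That product is at most `exp(recipSum N x + O(1))`, while the sum of `1/N(m)` is at least `c
log x`. -/
lemma Regular.recipSum_lower (h : Regular N) : ∃ C : ℝ, ∀ x : ℝ, 1 < x →
    Real.log (Real.log x) - C ≤ recipSum N x := by
  obtain ⟨c, hc, hlo⟩ := h.le_sum_inv
  obtain ⟨K, hK, hsq⟩ := h.sum_gens_sq_le
  refine ⟨2 * K - Real.log c, fun x hx => ?_⟩
  set T := gensBelow N x
  set J := ⌊x⌋₊ + 1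
  have hy : ∀ p, (0 : ℝ) < (N p : ℝ)⁻¹ ∧ (N p : ℝ)⁻¹ ≤ 1 / 2 := by
    intro p
    have : (2 : ℝ) ≤ N p := by exact_mod_cast h.one_lt p
    refine ⟨by positivity, ?_⟩
    rw [one_div]
    gcongr
  have hsub : below N x ⊆ T.finsupp (fun _ => Finset.range J) := by
    intro m hm
    rw [h.mem_below] at hm
    refine Finset.mem_finsupp_iff.2 ⟨fun p hp => ?_, fun p _ => ?_⟩
    · refine h.mem_gensBelow.2 (le_trans ?_ hm)
      exact_mod_cast le_monoidNorm_of_mem_support h.one_lt hp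
    · have h1 : monoidNorm N m ≤ ⌊x⌋₊ := Nat.le_floor hm
      have := multiplicity_lt_monoidNorm h.one_lt m p
      exact Finset.mem_range.2 (by omega)
  have h1 : ∑ m ∈ below N x, (monoidNorm N m : ℝ)⁻¹ ≤ Real.exp (recipSum N x + 2 * K) := by
    calc ∑ m ∈ below N x, (monoidNorm N m : ℝ)⁻¹
        ≤ ∑ m ∈ T.finsupp (fun _ => Finset.range J), (monoidNorm N m : ℝ)⁻¹ :=
          Finset.sum_le_sum_of_subset_of_nonneg hsub (fun _ _ _ => by positivity)
      _ = ∑ m ∈ T.finsupp (fun _ => Finset.range J), ∏ p ∈ T, ((N p : ℝ)⁻¹) ^ (m p) := by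
          refine Finset.sum_congr rfl fun m hm => ?_
          rw [← Real.rpow_neg_one, monoidNorm_rpow _ (Finset.mem_finsupp_iff.1 hm).1]
          refine Finset.prod_congr rfl fun p _ => ?_
          rw [Real.rpow_neg_one, inv_pow]
      _ = ∏ p ∈ T, ∑ j ∈ Finset.range J, ((N p : ℝ)⁻¹) ^ j :=
          sum_finsupp_prod T _ fun p j => ((N p : ℝ)⁻¹) ^ j
      _ ≤ ∏ p ∈ T, Real.exp ((N p : ℝ)⁻¹ + 2 * ((N p : ℝ)⁻¹) ^ 2) := by
          refine Finset.prod_le_prod (fun p _ => by positivity) fun p _ => ?_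
          obtain ⟨hy0, hy1⟩ := hy p
          set y := (N p : ℝ)⁻¹
          calc ∑ j ∈ Finset.range J, y ^ j ≤ (1 - y)⁻¹ := by
                rw [← tsum_geometric_of_lt_one hy0.le (by linarith)]
                exact (summable_geometric_of_lt_one hy0.le (by linarith)).sum_le_tsum _
                  (fun _ _ => by positivity)
            _ ≤ 1 + y + 2 * y ^ 2 := by
                rw [inv_le_iff_one_le_mul₀ (by linarith)]
                nlinarith [sq_nonneg y, mul_nonneg (sq_nonneg y) (show 0 ≤ 1 - 2 * y by linarith)]
            _ ≤ _ := by linarith [Real.add_one_le_exp (y + 2 * y ^ 2)]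
      _ = Real.exp (recipSum N x + 2 * ∑ p ∈ T, ((N p : ℝ)⁻¹) ^ 2) := by
          rw [← Real.exp_sum, Finset.sum_add_distrib, Finset.mul_sum, recipSum]
      _ ≤ _ := by
          gcongr
          exact hsq T
  have h2 := (hlo x hx.le).trans h1
  have h3 := Real.log_pos hx
  rw [← Real.log_le_iff_le_exp (by positivity), Real.log_mul hc.ne' h3.ne'] at h2
  linarith

/-- The product of the `1 + N(p)^(-1-δ)` expands into squarefree elements only, so it is bounded by
the zeta function, that is by `C / δ`. Taking logarithms costs a convergent sum of squares. -/
lemma Regular.sum_gens_rpow_le_log (h : Regular N) : ∃ C : ℝ, ∀ δ : ℝ, 0 < δ → δ ≤ 1 →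
    ∀ T : Finset P, ∑ p ∈ T, (N p : ℝ) ^ (-(1 + δ)) ≤ Real.log δ⁻¹ + C := by
  obtain ⟨C, hC, hz⟩ := h.zeta_le
  obtain ⟨K, hK, hsq⟩ := h.sum_gens_sq_le
  refine ⟨Real.log C + K, fun δ hδ hδ1 T => ?_⟩
  have h1 : Real.exp (∑ p ∈ T, (N p : ℝ) ^ (-(1 + δ)) - K) ≤ C / δ := by
    calc Real.exp (∑ p ∈ T, (N p : ℝ) ^ (-(1 + δ)) - K)
        ≤ Real.exp (∑ p ∈ T, ((N p : ℝ) ^ (-(1 + δ)) - ((N p : ℝ) ^ (-(1 + δ))) ^ 2)) := by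
          rw [Finset.sum_sub_distrib]
          gcongr
          refine le_trans (Finset.sum_le_sum fun p _ => ?_) (hsq T)
          have h1 : (1 : ℝ) ≤ N p := by exact_mod_cast (h.one_lt p).le
          rw [← Real.rpow_neg_one (N p : ℝ)]
          gcongr
          linarith
      _ = ∏ p ∈ T, Real.exp ((N p : ℝ) ^ (-(1 + δ)) - ((N p : ℝ) ^ (-(1 + δ))) ^ 2) :=
          Real.exp_sum _ _
      _ ≤ ∏ p ∈ T, ∑ j ∈ Finset.range 2, ((N p : ℝ) ^ j) ^ (-(1 + δ)) := by
          refine Finset.prod_le_prod (fun p _ => by positivity) fun p _ => ?_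
          have hy0 : 0 ≤ (N p : ℝ) ^ (-(1 + δ)) := by positivity
          simp only [Finset.sum_range_succ, Finset.sum_range_zero, pow_zero, pow_one, zero_add,
            Real.one_rpow]
          set y := (N p : ℝ) ^ (-(1 + δ))
          -- This yields `exp(y - y²) ≤ 1 + y`, since `(1 + y)(1 - y + y²) = 1 + y³ ≥ 1`.
          have h2 := Real.add_one_le_exp (-(y - y ^ 2))
          rw [Real.exp_neg, ← one_div, le_div_iff₀ (Real.exp_pos _)] at h2
          have h3 : 0 < Real.exp (y - y ^ 2) := Real.exp_pos _
          have h4 : 0 ≤ y ^ 3 * Real.exp (y - y ^ 2) := by positivity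
          nlinarith [mul_le_mul_of_nonneg_left h2 (show 0 ≤ 1 + y by linarith)]
      _ = ∑ m ∈ T.finsupp (fun _ => Finset.range 2), ∏ p ∈ T, ((N p : ℝ) ^ (m p)) ^ (-(1 + δ)) :=
          (sum_finsupp_prod T (fun _ => Finset.range 2)
            fun p j => ((N p : ℝ) ^ j) ^ (-(1 + δ))).symm
      _ = ∑ m ∈ T.finsupp (fun _ => Finset.range 2), (monoidNorm N m : ℝ) ^ (-(1 + δ)) := by
          refine Finset.sum_congr rfl fun m hm => ?_
          rw [monoidNorm_rpow _ (Finset.mem_finsupp_iff.1 hm).1]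
      _ ≤ C / δ := hz δ hδ hδ1 _
  rw [← Real.le_log_iff_exp_le (by positivity), div_eq_mul_inv,
    Real.log_mul hC.ne' (by positivity)] at h1
  linarith

lemma tendsto_log_log : Tendsto (fun x : ℝ => Real.log (Real.log x)) atTop atTop :=
  Real.tendsto_log_atTop.comp Real.tendsto_log_atTop

/-- Used for the error term in Mertens' theorem and for the shift `2 log L` caused by the cutoff. -/
lemma isLittleO_log_add_const_sqrt (C : ℝ) :
    (fun L : ℝ => 3 * Real.log L + C) =o[atTop] fun L => Real.sqrt L := by
  have h1 : (fun L : ℝ => Real.log L) =o[atTop] fun L => Real.sqrt L := by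
    simpa [Real.sqrt_eq_rpow] using isLittleO_log_rpow_atTop (r := 1 / 2) (by norm_num)
  have h2 : (fun _ : ℝ => C) =o[atTop] fun L : ℝ => Real.sqrt L :=
    isLittleO_const_left.2 (Or.inr (tendsto_norm_atTop_atTop.comp Real.tendsto_sqrt_atTop))
  exact (h1.const_mul_left 3).add h2

/-- **Mertens' theorem**, with a weak error term. -/
lemma Regular.recipSum_sub_isLittleO (h : Regular N) :
    (fun x => recipSum N x - Real.log (Real.log x)) =o[atTop]
      fun x => Real.sqrt (Real.log (Real.log x)) := by
  obtain ⟨C₁, hlo⟩ := h.recipSum_lower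
  obtain ⟨C₂, hup⟩ := h.sum_gens_rpow_le_log
  have key := (isLittleO_log_add_const_sqrt (|C₁| + 3 * |C₂| + 2)).comp_tendsto tendsto_log_log
  refine IsBigO.trans_isLittleO (IsBigO.of_bound 1 ?_) key
  filter_upwards [eventually_gt_atTop 1, Real.tendsto_log_atTop.eventually_ge_atTop 1,
    tendsto_log_log.eventually_ge_atTop 1] with x hx hlx hL
  have hlo := hlo x hx
  simp only [Function.comp_apply]
  set L := Real.log (Real.log x)
  have hlogL : 0 ≤ Real.log L := Real.log_nonneg hL
  have hup : recipSum N x ≤ (1 + 2 / L) * (L + Real.log L + |C₂|) := by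
    -- The choice `δ = 1 / log x` would lose a factor `e` when passing from exponent `1 + δ` to 1.
    -- The extra `L` makes `x ^ δ = exp(1/L)`, close to 1, and costs only an added `log L`.
    set δ := (Real.log x * L)⁻¹
    have hxL : 1 ≤ Real.log x * L := one_le_mul_of_one_le_of_one_le hlx hL
    have hδ0 : 0 < δ := by positivity
    have hδ1 : δ ≤ 1 := inv_le_one_of_one_le₀ hxL
    have h1 := hup δ hδ0 hδ1 (gensBelow N x)
    have h2 : Real.log δ⁻¹ = L + Real.log L := by
      rw [inv_inv, Real.log_mul (by positivity) (by positivity)]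
    have h3 : Real.exp (1 / L) ≤ 1 + 2 / L := by
      have : 1 / L ≤ 1 := by rw [div_le_one (by linarith)]; exact hL
      have h0 : 0 ≤ 1 / L := by positivity
      have := Real.abs_exp_sub_one_le (x := 1 / L) (by rwa [abs_of_nonneg h0])
      rw [abs_of_nonneg h0] at this
      have := (abs_le.1 this).2
      have e : 2 * (1 / L) = 2 / L := by ring
      linarith
    calc recipSum N x = ∑ p ∈ gensBelow N x, (N p : ℝ)⁻¹ := rfl
      _ ≤ ∑ p ∈ gensBelow N x, Real.exp (1 / L) * (N p : ℝ) ^ (-(1 + δ)) := by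
          refine Finset.sum_le_sum fun p hp => ?_
          have hp0 : (0 : ℝ) < N p := by exact_mod_cast (zero_lt_one.trans (h.one_lt p))
          have hpx := h.mem_gensBelow.1 hp
          have e1 : Real.exp (1 / L) = x ^ δ := by
            rw [Real.rpow_def_of_pos (by linarith)]
            congr 1
            simp only [δ]
            field_simp
          have e2 : (N p : ℝ)⁻¹ = (N p : ℝ) ^ δ * (N p : ℝ) ^ (-(1 + δ)) := by
            rw [← Real.rpow_add hp0, ← Real.rpow_neg_one]
            ring_nf
          rw [e1, e2]
          gcongr
      _ = Real.exp (1 / L) * ∑ p ∈ gensBelow N x, (N p : ℝ) ^ (-(1 + δ)) := by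
          rw [Finset.mul_sum]
      _ ≤ (1 + 2 / L) * (L + Real.log L + |C₂|) := by
          gcongr
          rw [h2] at h1
          linarith [le_abs_self C₂]
  have e : (1 + 2 / L) * (L + Real.log L + |C₂|)
      = L + Real.log L + |C₂| + 2 + (2 * Real.log L + 2 * |C₂|) / L := by
    field_simp; ring
  have e2 : (2 * Real.log L + 2 * |C₂|) / L ≤ 2 * Real.log L + 2 * |C₂| :=
    div_le_self (by positivity) hL
  have h0 : 0 ≤ |C₁| := abs_nonneg _
  have h0' : 0 ≤ |C₂| := abs_nonneg _
  rw [one_mul, Real.norm_eq_abs, Real.norm_eq_abs, abs_of_nonneg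
    (show 0 ≤ 3 * Real.log L + (|C₁| + 3 * |C₂| + 2) by positivity), abs_le]
  constructor
  · linarith [le_abs_self C₁]
  · linarith

end Mertens

/-! ### Truncated binomial expansion -/

section BinomialRemainder

/-- A complex Bonferroni inequality. By Pascal's rule the remainder for `n + 1` is `1 + u` times
that for `n`, plus `n.choose R * u ^ (R + 1)`; since `‖1 + u‖ ≤ 1` the bounds add up by Pascal's
rule again. -/
lemma norm_one_add_pow_sub_le {u : ℂ} (hu : ‖1 + u‖ ≤ 1) (R n : ℕ) :
    ‖(1 + u) ^ n - ∑ j ∈ Finset.range (R + 1), (n.choose j : ℂ) * u ^ j‖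
      ≤ n.choose (R + 1) * ‖u‖ ^ (R + 1) := by
  induction n with
  | zero =>
    rw [Finset.sum_range_succ']
    simp
  | succ n ih =>
    have e : (1 + u) ^ (n + 1) - ∑ j ∈ Finset.range (R + 1), ((n + 1).choose j : ℂ) * u ^ j
        = (1 + u) * ((1 + u) ^ n - ∑ j ∈ Finset.range (R + 1), (n.choose j : ℂ) * u ^ j)
          + n.choose R * u ^ (R + 1) := by
      have h1 : ∑ j ∈ Finset.range (R + 1), ((n + 1).choose j : ℂ) * u ^ j
          = ∑ j ∈ Finset.range (R + 1), (n.choose j : ℂ) * u ^ j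
            + ∑ j ∈ Finset.range R, (n.choose j : ℂ) * u ^ (j + 1) := by
        rw [Finset.sum_range_succ' (fun j => ((n + 1).choose j : ℂ) * u ^ j),
          Finset.sum_range_succ' (fun j => (n.choose j : ℂ) * u ^ j)]
        simp only [Nat.choose_succ_succ, Nat.succ_eq_add_one, Nat.cast_add, add_mul,
          Finset.sum_add_distrib, Nat.choose_zero_right]
        ring
      have h2 : u * ∑ j ∈ Finset.range (R + 1), (n.choose j : ℂ) * u ^ j
          = ∑ j ∈ Finset.range R, (n.choose j : ℂ) * u ^ (j + 1) + n.choose R * u ^ (R + 1) := by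
        rw [Finset.sum_range_succ, mul_add, Finset.mul_sum]
        congr 1
        · exact Finset.sum_congr rfl fun j _ => by ring
        · ring
      rw [h1]
      linear_combination h2
    rw [e]
    refine (norm_add_le _ _).trans ?_
    rw [norm_mul, norm_mul, norm_pow, Complex.norm_natCast, Nat.choose_succ_succ]
    push_cast
    have := mul_le_mul hu ih (norm_nonneg _) zero_le_one
    linarith

end BinomialRemainder

/-! ### Averages under approximate independence -/

section Sieve

variable {P : Type*}

/-- The number of elements of `T` that occur in `n`. -/
noncomputable def omegaOn (T : Finset P) (n : FreeMonoidOn P) : ℕ :=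
  (T.filter fun p => n p ≠ 0).card

lemma choose_omegaOn (T : Finset P) (n : FreeMonoidOn P) (j : ℕ) :
    (omegaOn T n).choose j =
      ((T.powersetCard j).filter fun D => ∀ p ∈ D, n p ≠ 0).card := by
  classical
  rw [omegaOn, ← Finset.card_powersetCard]
  congr 1
  ext D
  simp only [Finset.mem_powersetCard, Finset.mem_filter, Finset.subset_iff]
  grind

/-- Rankin's trick: doubling each factor gains at least `2 ^ (R + 1)` on the large subsets, and the
sum over all subsets is a product bounded by an exponential. -/
lemma sum_tail_powerset_le (T : Finset P) (x : P → ℝ) (hx : ∀ p, 0 ≤ x p) {v : ℝ} (hv : 0 ≤ v)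
    (R : ℕ) :
    ∑ D ∈ T.powerset with R + 1 ≤ D.card, ∏ p ∈ D, v * x p
      ≤ (1 / 2) ^ (R + 1) * Real.exp (2 * v * ∑ p ∈ T, x p) := by
  calc ∑ D ∈ T.powerset with R + 1 ≤ D.card, ∏ p ∈ D, v * x p
      ≤ ∑ D ∈ T.powerset with R + 1 ≤ D.card, (1 / 2) ^ (R + 1) * ∏ p ∈ D, 2 * v * x p := by
        refine Finset.sum_le_sum fun D hD => ?_
        have hD' := (Finset.mem_filter.1 hD).2
        have e : ∏ p ∈ D, v * x p = (1 / 2) ^ D.card * ∏ p ∈ D, 2 * v * x p := by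
          rw [← Finset.prod_const, ← Finset.prod_mul_distrib]
          exact Finset.prod_congr rfl fun p _ => by ring
        rw [e]
        have : 0 ≤ ∏ p ∈ D, 2 * v * x p :=
          Finset.prod_nonneg fun p _ => mul_nonneg (by positivity) (hx p)
        exact mul_le_mul_of_nonneg_right
          (pow_le_pow_of_le_one (by norm_num) (by norm_num) hD') this
    _ ≤ ∑ D ∈ T.powerset, (1 / 2) ^ (R + 1) * ∏ p ∈ D, 2 * v * x p := by
        refine Finset.sum_le_sum_of_subset_of_nonneg (Finset.filter_subset _ _) fun D _ _ => ?_
        have : 0 ≤ ∏ p ∈ D, 2 * v * x p :=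
          Finset.prod_nonneg fun p _ => mul_nonneg (by positivity) (hx p)
        positivity
    _ = (1 / 2) ^ (R + 1) * ∏ p ∈ T, (1 + 2 * v * x p) := by
        rw [Finset.prod_one_add, Finset.mul_sum]
    _ ≤ (1 / 2) ^ (R + 1) * Real.exp (∑ p ∈ T, 2 * v * x p) := by
        gcongr
        rw [Real.exp_sum]
        refine Finset.prod_le_prod (fun p _ => ?_) fun p _ => ?_
        · have := hx p
          positivity
        · linarith [Real.add_one_le_exp (2 * v * x p)]
    _ = _ := by rw [Finset.mul_sum]

/-- If the joint occurrences of the elements of `T` are approximately independent on average over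
`Ω`, then the generating function of the number of those that occur is close to a product. -/
lemma norm_average_one_add_pow_sub_prod_le (Ω : Finset (FreeMonoidOn P)) (hΩ : Ω.Nonempty)
    (T : Finset P) (x : P → ℝ) (hx : ∀ p, 0 ≤ x p) {η : ℝ}
    (hη : ∀ D ⊆ T, |((Ω.filter fun n => ∀ p ∈ D, n p ≠ 0).card : ℝ) / Ω.card - ∏ p ∈ D, x p| ≤ η)
    {u : ℂ} (hu : ‖1 + u‖ ≤ 1) {b : ℝ} (hb : 1 ≤ b) (hub : ‖u‖ * T.card ≤ b) (R : ℕ) :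
    ‖(∑ n ∈ Ω, (1 + u) ^ omegaOn T n) / Ω.card - ∏ p ∈ T, (1 + u * x p)‖
      ≤ η * ((R + 2) * b ^ (R + 1))
        + 2 * ((1 / 2) ^ (R + 1) * Real.exp (2 * ‖u‖ * ∑ p ∈ T, x p)) := by
  classical
  have hη0 : 0 ≤ η := (abs_nonneg _).trans (hη ∅ (Finset.empty_subset _))
  have hc : (0 : ℝ) < Ω.card := by exact_mod_cast hΩ.card_pos
  -- `A j` is the average number of `j`-subsets of `T` that occur in `n`; `e j`, an elementary
  -- symmetric polynomial, is its value under exact independence.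
  set A : ℕ → ℝ := fun j => (∑ n ∈ Ω, ((omegaOn T n).choose j : ℝ)) / Ω.card
  set e : ℕ → ℝ := fun j => ∑ D ∈ T.powersetCard j, ∏ p ∈ D, x p
  have hAe : ∀ j, |A j - e j| ≤ η * (T.card : ℝ) ^ j := by
    intro j
    have h1 : A j = ∑ D ∈ T.powersetCard j,
        ((Ω.filter fun n => ∀ p ∈ D, n p ≠ 0).card : ℝ) / Ω.card := by
      simp only [A]
      rw [← Finset.sum_div]
      congr 1
      simp only [choose_omegaOn, Finset.card_filter]
      push_cast
      exact Finset.sum_comm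
    rw [h1]
    simp only [e]
    rw [← Finset.sum_sub_distrib]
    refine (Finset.abs_sum_le_sum_abs _ _).trans ?_
    refine (Finset.sum_le_card_nsmul _ _ η fun D hD =>
      hη D (Finset.mem_powersetCard.1 hD).1).trans ?_
    rw [nsmul_eq_mul, Finset.card_powersetCard, mul_comm]
    gcongr
    exact_mod_cast Nat.choose_le_pow _ _
  have hE : ∀ j, (‖u‖ * T.card) ^ j ≤ b ^ j := fun j => by gcongr
  have hterm : ∀ j ≤ R + 1, ‖u‖ ^ j * |A j - e j| ≤ η * b ^ (R + 1) := by
    intro j hj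
    calc ‖u‖ ^ j * |A j - e j| ≤ ‖u‖ ^ j * (η * (T.card : ℝ) ^ j) := by gcongr; exact hAe j
      _ = η * (‖u‖ * T.card) ^ j := by ring
      _ ≤ η * b ^ (R + 1) := by
          gcongr
          exact (hE j).trans (pow_le_pow_right₀ hb hj)
  -- truncated expansion of the average
  have hmain : ‖(∑ n ∈ Ω, (1 + u) ^ omegaOn T n) / Ω.card
      - ∑ j ∈ Finset.range (R + 1), (A j : ℂ) * u ^ j‖ ≤ ‖u‖ ^ (R + 1) * A (R + 1) := by
    have h1 : (∑ n ∈ Ω, (1 + u) ^ omegaOn T n) / Ω.card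
        - ∑ j ∈ Finset.range (R + 1), (A j : ℂ) * u ^ j
        = (∑ n ∈ Ω, ((1 + u) ^ omegaOn T n
          - ∑ j ∈ Finset.range (R + 1), ((omegaOn T n).choose j : ℂ) * u ^ j)) / Ω.card := by
      rw [Finset.sum_sub_distrib, sub_div, Finset.sum_comm]
      congr 1
      rw [Finset.sum_div]
      refine Finset.sum_congr rfl fun j _ => ?_
      simp only [A]
      push_cast
      rw [← Finset.sum_mul]
      ring
    rw [h1, norm_div, Complex.norm_natCast, div_le_iff₀ hc]
    refine (norm_sum_le _ _).trans ((Finset.sum_le_sum fun n _ =>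
      norm_one_add_pow_sub_le hu R _).trans (le_of_eq ?_))
    simp only [A]
    rw [← Finset.sum_mul]
    field_simp
  set B : ℝ := ∑ D ∈ T.powerset with R + 1 ≤ D.card, ∏ p ∈ D, ‖u‖ * x p
  have hB := sum_tail_powerset_le T x hx (norm_nonneg u) R
  have hprod0 : ∀ D : Finset P, 0 ≤ ∏ p ∈ D, ‖u‖ * x p := fun D =>
    Finset.prod_nonneg fun p _ => mul_nonneg (norm_nonneg u) (hx p)
  have hpow : ∀ j, ‖u‖ ^ j * e j = ∑ D ∈ T.powersetCard j, ∏ p ∈ D, ‖u‖ * x p := by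
    intro j
    simp only [e]
    rw [Finset.mul_sum]
    refine Finset.sum_congr rfl fun D hD => ?_
    rw [Finset.prod_mul_distrib, Finset.prod_const, (Finset.mem_powersetCard.1 hD).2]
  have heR : ‖u‖ ^ (R + 1) * e (R + 1) ≤ B := by
    rw [hpow]
    refine Finset.sum_le_sum_of_subset_of_nonneg (fun D hD => ?_) fun D _ _ => hprod0 D
    obtain ⟨h1, h2⟩ := Finset.mem_powersetCard.1 hD
    exact Finset.mem_filter.2 ⟨Finset.mem_powerset.2 h1, h2.ge⟩
  -- truncated expansion of the product
  have hprod : ‖∏ p ∈ T, (1 + u * x p) - ∑ j ∈ Finset.range (R + 1), (e j : ℂ) * u ^ j‖ ≤ B := by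
    have h1 : ∑ j ∈ Finset.range (R + 1), (e j : ℂ) * u ^ j
        = ∑ D ∈ T.powerset with ¬ (R + 1 ≤ D.card), ∏ p ∈ D, u * x p := by
      rw [← Finset.sum_fiberwise_of_maps_to (s := T.powerset.filter fun D => ¬ (R + 1 ≤ D.card))
        (t := Finset.range (R + 1)) (g := Finset.card)
        (fun D hD => by
          have := (Finset.mem_filter.1 hD).2
          exact Finset.mem_range.2 (by omega))]
      refine Finset.sum_congr rfl fun j hj => ?_
      have hj' := Finset.mem_range.1 hj
      simp only [e]
      push_cast
      rw [Finset.sum_mul]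
      refine Finset.sum_congr ?_ fun D hD => ?_
      · ext D
        simp only [Finset.mem_powersetCard, Finset.mem_filter, Finset.mem_powerset]
        constructor
        · rintro ⟨h1, h2⟩
          exact ⟨⟨h1, by omega⟩, h2⟩
        · rintro ⟨⟨h1, _⟩, h2⟩
          exact ⟨h1, h2⟩
      · rw [Finset.prod_mul_distrib, Finset.prod_const, (Finset.mem_filter.1 hD).2]
        ring
    rw [h1, Finset.prod_one_add, ← Finset.sum_filter_add_sum_filter_not T.powerset
      (fun D => R + 1 ≤ D.card), add_sub_cancel_right]
    refine (norm_sum_le _ _).trans (le_of_eq (Finset.sum_congr rfl fun D _ => ?_))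
    rw [norm_prod]
    refine Finset.prod_congr rfl fun p _ => ?_
    rw [norm_mul, Complex.norm_real, Real.norm_of_nonneg (hx p)]
  have hmid : ‖∑ j ∈ Finset.range (R + 1), (A j : ℂ) * u ^ j
      - ∑ j ∈ Finset.range (R + 1), (e j : ℂ) * u ^ j‖ ≤ (R + 1) * (η * b ^ (R + 1)) := by
    rw [← Finset.sum_sub_distrib]
    refine (norm_sum_le _ _).trans ((Finset.sum_le_card_nsmul _ _ (η * b ^ (R + 1))
      fun j hj => ?_).trans (le_of_eq ?_))
    · rw [← sub_mul, norm_mul, norm_pow, ← Complex.ofReal_sub, Complex.norm_real,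
        Real.norm_eq_abs, mul_comm]
      exact hterm j (Finset.mem_range.1 hj).le
    · simp
  -- The truncation error is itself an average of binomial coefficients, so it too is compared with
  -- the independent model; this explains `R + 2` copies of `η` and two copies of the tail `B`.
  have hAR : ‖u‖ ^ (R + 1) * A (R + 1) ≤ η * b ^ (R + 1) + B := by
    have h1 := hterm (R + 1) le_rfl
    have h2 : A (R + 1) ≤ |A (R + 1) - e (R + 1)| + e (R + 1) := by
      linarith [le_abs_self (A (R + 1) - e (R + 1))]
    calc ‖u‖ ^ (R + 1) * A (R + 1)
        ≤ ‖u‖ ^ (R + 1) * (|A (R + 1) - e (R + 1)| + e (R + 1)) := by gcongr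
      _ ≤ _ := by rw [mul_add]; linarith
  have htri := norm_sub_le_norm_sub_add_norm_sub
    ((∑ n ∈ Ω, (1 + u) ^ omegaOn T n) / Ω.card)
    (∑ j ∈ Finset.range (R + 1), (A j : ℂ) * u ^ j) (∏ p ∈ T, (1 + u * x p))
  have htri2 := norm_sub_le_norm_sub_add_norm_sub
    (∑ j ∈ Finset.range (R + 1), (A j : ℂ) * u ^ j)
    (∑ j ∈ Finset.range (R + 1), (e j : ℂ) * u ^ j) (∏ p ∈ T, (1 + u * x p))
  rw [norm_sub_rev (∑ j ∈ Finset.range (R + 1), (e j : ℂ) * u ^ j)] at htri2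
  nlinarith [htri, htri2, hmain, hmid, hAR, hprod, hB]

lemma re_nonpos_of_norm_one_add_le {u : ℂ} (hu : ‖1 + u‖ ≤ 1) : u.re ≤ 0 := by
  have h1 : ‖1 + u‖ ^ 2 ≤ 1 := pow_le_one₀ (norm_nonneg _) hu
  rw [← Complex.normSq_eq_norm_sq, Complex.normSq_apply] at h1
  simp only [Complex.add_re, Complex.one_re, Complex.add_im, Complex.one_im] at h1
  nlinarith [sq_nonneg u.re, sq_nonneg u.im]

lemma norm_prod_sub_prod_le_sum (T : Finset P) (f g : P → ℂ) (hf : ∀ p, ‖f p‖ ≤ 1)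
    (hg : ∀ p, ‖g p‖ ≤ 1) : ‖∏ p ∈ T, f p - ∏ p ∈ T, g p‖ ≤ ∑ p ∈ T, ‖f p - g p‖ := by
  classical
  induction T using Finset.induction_on with
  | empty => simp
  | insert a T ha ih =>
    rw [Finset.prod_insert ha, Finset.prod_insert ha, Finset.sum_insert ha]
    have h1 : ‖∏ p ∈ T, f p‖ ≤ 1 := by
      rw [norm_prod]
      exact Finset.prod_le_one (fun _ _ => norm_nonneg _) fun p _ => hf p
    calc ‖f a * ∏ p ∈ T, f p - g a * ∏ p ∈ T, g p‖
        = ‖(f a - g a) * ∏ p ∈ T, f p + g a * (∏ p ∈ T, f p - ∏ p ∈ T, g p)‖ := by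
          congr 1; ring
      _ ≤ ‖f a - g a‖ * ‖∏ p ∈ T, f p‖ + ‖g a‖ * ‖∏ p ∈ T, f p - ∏ p ∈ T, g p‖ := by
          refine (norm_add_le _ _).trans ?_
          rw [norm_mul, norm_mul]
      _ ≤ ‖f a - g a‖ * 1 + 1 * ∑ p ∈ T, ‖f p - g p‖ := by
          gcongr
          exact hg a
      _ = _ := by ring

/-- All factors lie in the unit disc: `1 + u * x p` is a convex combination of 1 and `1 + u`, and
`u` has nonpositive real part. So the products differ by at most the sum of the differences, each
quadratic in `u * x p`. -/
lemma norm_prod_one_add_sub_exp_le (T : Finset P) (x : P → ℝ) (hx : ∀ p, 0 ≤ x p)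
    (hx1 : ∀ p, x p ≤ 1 / 2) {u : ℂ} (hu : ‖1 + u‖ ≤ 1) :
    ‖∏ p ∈ T, (1 + u * x p) - Complex.exp (u * ∑ p ∈ T, x p)‖ ≤ ‖u‖ ^ 2 * ∑ p ∈ T, x p ^ 2 := by
  have hu2 : ‖u‖ ≤ 2 := by
    have := norm_sub_le (1 + u) 1
    rw [add_sub_cancel_left, norm_one] at this
    linarith
  have hre := re_nonpos_of_norm_one_add_le hu
  have e : Complex.exp (u * ∑ p ∈ T, x p) = ∏ p ∈ T, Complex.exp (u * x p) := by
    rw [← Complex.exp_sum]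
    push_cast
    rw [Finset.mul_sum]
  rw [e]
  refine (norm_prod_sub_prod_le_sum T _ _ (fun p => ?_) fun p => ?_).trans ?_
  · have h1 : 1 + u * x p = ((1 - x p : ℝ) : ℂ) + (x p : ℂ) * (1 + u) := by push_cast; ring
    rw [h1]
    refine (norm_add_le _ _).trans ?_
    rw [norm_mul, Complex.norm_real, Complex.norm_real, Real.norm_of_nonneg (hx p),
      Real.norm_of_nonneg (by linarith [hx1 p])]
    nlinarith [hx p, hx1 p]
  · rw [Complex.norm_exp]
    refine Real.exp_le_one_iff.2 ?_
    rw [Complex.re_mul_ofReal]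
    exact mul_nonpos_of_nonpos_of_nonneg hre (hx p)
  · rw [Finset.mul_sum]
    refine Finset.sum_le_sum fun p _ => ?_
    have hn : ‖u * x p‖ = ‖u‖ * x p := by
      rw [norm_mul, Complex.norm_real, Real.norm_of_nonneg (hx p)]
    have h1 : ‖u * x p‖ ≤ 1 := by
      rw [hn]
      nlinarith [hx p, hx1 p, norm_nonneg u]
    have h2 := Complex.norm_exp_sub_one_sub_id_le h1
    rw [norm_sub_rev, show Complex.exp (u * x p) - (1 + u * x p)
      = Complex.exp (u * x p) - 1 - u * x p by ring]
    refine h2.trans (le_of_eq ?_)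
    rw [hn]
    ring

end Sieve

/-! ### Characteristic function of the truncated count -/

section Characteristic

variable {P : Type*} {N : P → ℕ}

/-- The iterated logarithm `log log y`. -/
noncomputable def loglog (y : ℝ) : ℝ := Real.log (Real.log y)

lemma tendsto_loglog : Tendsto loglog atTop atTop := tendsto_log_log

/-- The truncation point for the generators in the proof of the Erdős–Kac theorem. -/
noncomputable def cutoff (y : ℝ) : ℝ := Real.exp (Real.log y / loglog y ^ 2)

lemma exp_loglog {y : ℝ} (hy : 1 < y) : Real.exp (loglog y) = Real.log y :=
  Real.exp_log (Real.log_pos hy)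

lemma tendsto_cutoff : Tendsto cutoff atTop atTop := by
  have h := (Real.tendsto_exp_div_pow_atTop 2).comp tendsto_loglog
  refine Real.tendsto_exp_atTop.comp (h.congr' ?_)
  filter_upwards [eventually_gt_atTop 1] with y hy
  simp only [Function.comp_apply, exp_loglog hy]

lemma loglog_cutoff {y : ℝ} (hy : 1 < y) (hL : 0 < loglog y) :
    loglog (cutoff y) = loglog y - 2 * Real.log (loglog y) := by
  rw [loglog, cutoff, Real.log_exp, Real.log_div (Real.log_pos hy).ne' (by positivity),
    Real.log_pow]
  rfl

lemma Regular.tendsto_recipSum_sub (h : Regular N) :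
    Tendsto (fun y => (recipSum N y - loglog y) / Real.sqrt (loglog y)) atTop (𝓝 0) :=
  h.recipSum_sub_isLittleO.tendsto_div_nhds_zero

/-- The cutoff lowers the iterated logarithm only by `2 log L`, which is `o(√L)`; truncation
therefore affects neither centring nor scale. -/
lemma Regular.tendsto_recipSum_cutoff_sub (h : Regular N) :
    Tendsto (fun y => (recipSum N (cutoff y) - loglog y) / Real.sqrt (loglog y)) atTop (𝓝 0) := by
  have h1 : (fun y => recipSum N (cutoff y) - loglog (cutoff y)) =o[atTop]
      fun y => Real.sqrt (loglog y) := by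
    refine (h.recipSum_sub_isLittleO.comp_tendsto tendsto_cutoff).trans_isBigO
      (IsBigO.of_bound 1 ?_)
    filter_upwards [eventually_gt_atTop 1, tendsto_loglog.eventually_ge_atTop 1] with y hy hL
    rw [one_mul, Function.comp_apply, Real.norm_of_nonneg (Real.sqrt_nonneg _),
      Real.norm_of_nonneg (Real.sqrt_nonneg _)]
    refine Real.sqrt_le_sqrt ?_
    have := loglog_cutoff hy (by linarith)
    simp only [loglog] at this ⊢
    rw [this]
    have := Real.log_nonneg hL
    simp only [loglog] at this
    linarith
  have h2 : (fun y => loglog (cutoff y) - loglog y) =o[atTop] fun y => Real.sqrt (loglog y) := by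
    have := ((isLittleO_log_add_const_sqrt 0).comp_tendsto tendsto_loglog).const_mul_left (-2 / 3)
    refine this.congr' ?_ EventuallyEq.rfl
    filter_upwards [eventually_gt_atTop 1, tendsto_loglog.eventually_ge_atTop 1] with y hy hL
    rw [loglog_cutoff hy (by linarith)]
    simp only [Function.comp_apply]
    ring
  refine ((h1.add h2).congr_left fun y => ?_).tendsto_div_nhds_zero
  ring

/-- The generators in `D` all occur in `n` exactly when `n` lies above their sum, so this is the
level of distribution at that sum. -/
lemma Regular.abs_average_sub_le (h : Regular N) : ∃ C θ : ℝ, 0 < C ∧ θ < 1 ∧ ∀ y : ℝ, 1 ≤ y →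
    ∀ D : Finset P, |(((below N y).filter fun n => ∀ p ∈ D, n p ≠ 0).card : ℝ) / (below N y).card
      - ∏ p ∈ D, (N p : ℝ)⁻¹| ≤ C * (y ^ θ / y) := by
  classical
  obtain ⟨C, θ, hC, -, hθ1, hlev⟩ := h.level
  obtain ⟨c, hc, hlo⟩ := h.lower
  refine ⟨C / c, θ, by positivity, hθ1, fun y hy D => ?_⟩
  have hF := hlo y hy
  have hF0 : (0 : ℝ) < (below N y).card := lt_of_lt_of_le (by positivity) hF
  set d : FreeMonoidOn P := ∑ p ∈ D, Finsupp.single p 1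
  have hd : ∀ p, d p = if p ∈ D then 1 else 0 := by
    intro p
    simp [d, Finsupp.finsetSum_apply, Finsupp.single_apply]
  have hNd : (monoidNorm N d : ℝ)⁻¹ = ∏ p ∈ D, (N p : ℝ)⁻¹ := by
    rw [monoidNorm_sum]
    simp [monoidNorm_single]
  have hset : {n : FreeMonoidOn P | n ∈ below N y ∧ d ≤ n}.ncard
      = ((below N y).filter fun n => ∀ p ∈ D, n p ≠ 0).card := by
    rw [← Set.ncard_coe_finset]
    congr 1
    ext n
    simp only [Set.mem_ofPred_eq, Finset.coe_filter, Finsupp.le_def, hd]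
    refine and_congr_right fun _ => ⟨fun h1 p hp => ?_, fun h1 p => ?_⟩
    · have := h1 p
      rw [if_pos hp] at this
      omega
    · split_ifs with hp
      · exact Nat.one_le_iff_ne_zero.2 (h1 p hp)
      · exact Nat.zero_le _
  have h1 := hlev y hy d
  rw [hset, div_eq_mul_inv, hNd] at h1
  set cnt : ℝ := (((below N y).filter fun n => ∀ p ∈ D, n p ≠ 0).card : ℝ)
  have e : cnt / (below N y).card - ∏ p ∈ D, (N p : ℝ)⁻¹
      = (cnt - (below N y).card * ∏ p ∈ D, (N p : ℝ)⁻¹) / (below N y).card := by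
    field_simp
  rw [e, abs_div, abs_of_pos hF0]
  calc _ ≤ C * y ^ θ / (c * y) := by
        gcongr
    _ = C / c * (y ^ θ / y) := by field_simp

lemma eventually_error_le (K : ℝ) (hK : 1 ≤ K) {θ : ℝ} (hθ : θ < 1) :
    ∀ᶠ y : ℝ in atTop, y ^ θ / y * ((⌈2 * loglog y⌉₊ + 2)
      * (K * cutoff y) ^ (⌈2 * loglog y⌉₊ + 1)) ≤ Real.exp (-loglog y) := by
  have hlogK : 0 ≤ Real.log K := Real.log_nonneg hK
  have hε : 0 < (1 - θ) / 2 := by linarith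
  -- The saving `(1 - θ) log y` is split in two: one half absorbs `4 log y / L` from the cutoff, the
  -- other `5L` from `R + 2`, `4L log K`, and the `L` to be gained; hence `6 = 5 + 1`, with `log y =
  -- exp L`.
  have hexp : ∀ᶠ L : ℝ in atTop, (6 + 4 * Real.log K) * L ≤ (1 - θ) / 2 * Real.exp L := by
    have h0 : (fun L : ℝ => L) =o[atTop] Real.exp := by
      simpa using Real.isLittleO_pow_exp_atTop (n := 1)
    have := (h0.const_mul_left (6 + 4 * Real.log K)).def hε
    filter_upwards [this] with L hL
    rw [Real.norm_of_nonneg (Real.exp_pos L).le] at hL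
    exact (le_abs_self _).trans hL
  filter_upwards [eventually_gt_atTop 1, tendsto_loglog.eventually_ge_atTop 1,
    tendsto_loglog.eventually hexp, tendsto_loglog.eventually_ge_atTop (4 / ((1 - θ) / 2)),
    tendsto_cutoff.eventually_ge_atTop 1] with y hy hL hLe hL4 hz
  have hexpL := exp_loglog hy
  set L := loglog y
  set l := Real.log y
  have hl0 : 0 < l := Real.log_pos hy
  set R := ⌈2 * L⌉₊
  have hR : (R : ℝ) ≤ 2 * L + 1 := (Nat.ceil_lt_add_one (by positivity)).le
  have hb : 1 ≤ K * cutoff y := one_le_mul_of_one_le_of_one_le hK hz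
  have h1 : y ^ θ / y = Real.exp (-((1 - θ) * l)) := by
    rw [Real.rpow_def_of_pos (by linarith)]
    nth_rewrite 2 [← Real.exp_log (show 0 < y by linarith)]
    rw [← Real.exp_sub]
    congr 1
    ring
  have h2 : (R : ℝ) + 2 ≤ Real.exp (5 * L) := by
    have := Real.add_one_le_exp (5 * L)
    linarith
  have h3 : (K * cutoff y) ^ (R + 1) ≤ Real.exp (4 * L * Real.log K + 4 * l / L) := by
    calc (K * cutoff y) ^ (R + 1) = (K * cutoff y) ^ ((R + 1 : ℕ) : ℝ) := (Real.rpow_natCast _ _).symm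
      _ ≤ (K * cutoff y) ^ (4 * L) := by
          refine Real.rpow_le_rpow_of_exponent_le hb ?_
          push_cast
          linarith
      _ = Real.exp (4 * L * Real.log K + 4 * l / L) := by
          rw [Real.rpow_def_of_pos (by linarith), Real.log_mul (by positivity) (by positivity),
            cutoff, Real.log_exp]
          congr 1
          change (Real.log K + l / L ^ 2) * (4 * L) = _
          field_simp
  have h4 : 4 / L ≤ (1 - θ) / 2 := by
    rw [div_le_iff₀ (by positivity)]
    rwa [div_le_iff₀' hε] at hL4
  have h5 : 4 * l / L ≤ (1 - θ) / 2 * l := by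
    rw [mul_div_right_comm]
    gcongr
  rw [h1]
  calc Real.exp (-((1 - θ) * l)) * ((R + 2) * (K * cutoff y) ^ (R + 1))
      ≤ Real.exp (-((1 - θ) * l)) * (Real.exp (5 * L)
        * Real.exp (4 * L * Real.log K + 4 * l / L)) := by gcongr
    _ = Real.exp (-((1 - θ) * l) + (5 * L + (4 * L * Real.log K + 4 * l / L))) := by
        rw [← Real.exp_add, ← Real.exp_add]
    _ ≤ Real.exp (-L) := by
        gcongr
        rw [hexpL] at hLe
        linarith

/-- The average of the characteristic function of the truncated prime divisor function. -/
noncomputable def charAverage (N : P → ℕ) (s y : ℝ) : ℂ :=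
  (∑ n ∈ below N y, Complex.exp (s * (((omegaOn (gensBelow N (cutoff y)) n - loglog y)
    / Real.sqrt (loglog y) : ℝ) : ℂ) * Complex.I)) / (below N y).card

lemma Regular.tendsto_charAverage_sub (h : Regular N) (s : ℝ) :
    Tendsto (fun y => charAverage N s y
      - Complex.exp ((Complex.exp (Complex.I * ↑(s / Real.sqrt (loglog y))) - 1)
          * recipSum N (cutoff y) - Complex.I * ↑(s / Real.sqrt (loglog y)) * loglog y))
      atTop (𝓝 0) := by
  obtain ⟨C, θ, hC, hθ, hav⟩ := h.abs_average_sub_le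
  obtain ⟨C₁, hC₁, hup⟩ := h.upper
  obtain ⟨K, hK, hsq⟩ := h.sum_gens_sq_le
  have hbound : Tendsto (fun y => C * Real.exp (-loglog y) + 2 * Real.exp (-(loglog y / 2))
      + s ^ 2 / loglog y * K) atTop (𝓝 0) := by
    have t1 := (Real.tendsto_exp_neg_atTop_nhds_zero.comp tendsto_loglog).const_mul C
    have t2 := (Real.tendsto_exp_neg_atTop_nhds_zero.comp
      (tendsto_loglog.atTop_div_const (show (0 : ℝ) < 2 by norm_num))).const_mul 2
    have t3 := (tendsto_loglog.const_div_atTop (s ^ 2)).mul_const K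
    simpa using (t1.add t2).add t3
  have hS := h.tendsto_recipSum_cutoff_sub
  refine squeeze_zero_norm' ?_ hbound
  filter_upwards [eventually_gt_atTop 1, tendsto_loglog.eventually_ge_atTop 1,
    tendsto_loglog.eventually_ge_atTop ((8 * |s|) ^ 2),
    eventually_error_le (2 * C₁ + 1) (by linarith) hθ,
    tendsto_cutoff.eventually_ge_atTop 1, hS.eventually_le_const zero_lt_one]
    with y hy hL hLs herr hz hSy
  have hL0 : 0 < loglog y := by linarith
  set L := loglog y
  set T := gensBelow N (cutoff y)
  set τ : ℝ := s / Real.sqrt L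
  set u : ℂ := Complex.exp (Complex.I * τ) - 1
  -- Since `2 log 2 > 1`, this order makes `2^(-R-1) ≤ exp(-L)`, beating the factor `exp(L/2)` in
  -- the tail estimate; yet `cutoff y ^ (R + 1)` remains a small power of `y`.
  set R := ⌈2 * L⌉₊
  have hsqrt : 0 < Real.sqrt L := Real.sqrt_pos.2 hL0
  have hu : 1 + u = Complex.exp (Complex.I * τ) := by simp [u]
  have hu1 : ‖1 + u‖ ≤ 1 := by
    rw [hu, mul_comm, Complex.norm_exp_ofReal_mul_I]
  have huτ : ‖u‖ ≤ |τ| := Real.norm_exp_I_mul_ofReal_sub_one_le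
  have hu2 : ‖u‖ ≤ 2 := by
    have := norm_sub_le (1 + u) 1
    rw [add_sub_cancel_left, norm_one] at this
    linarith
  have hne : (below N y).Nonempty := by
    refine ⟨0, h.mem_below.2 ?_⟩
    simpa [monoidNorm_zero] using hy.le
  have hx0 : ∀ p, (0 : ℝ) ≤ (N p : ℝ)⁻¹ := fun p => by positivity
  have hx1 : ∀ p, (N p : ℝ)⁻¹ ≤ 1 / 2 := by
    intro p
    have : (2 : ℝ) ≤ N p := by exact_mod_cast h.one_lt p
    rw [one_div]
    gcongr
  have hS0 : 0 ≤ recipSum N (cutoff y) := Finset.sum_nonneg fun p _ => hx0 p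
  have hS2 : recipSum N (cutoff y) ≤ 2 * L := by
    rw [div_le_one hsqrt] at hSy
    have : Real.sqrt L ≤ L := by
      rw [Real.sqrt_le_left (by linarith)]
      nlinarith
    linarith
  have hcardT : ‖u‖ * T.card ≤ (2 * C₁ + 1) * cutoff y := by
    have h1 : (T.card : ℝ) ≤ C₁ * cutoff y :=
      le_trans (by exact_mod_cast h.card_gensBelow_le _) (hup _ (by linarith))
    calc ‖u‖ * T.card ≤ 2 * (C₁ * cutoff y) := by gcongr
      _ ≤ (2 * C₁ + 1) * cutoff y := by linarith
  have hb1 : 1 ≤ (2 * C₁ + 1) * cutoff y :=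
    one_le_mul_of_one_le_of_one_le (by linarith) hz
  have e1 := norm_average_one_add_pow_sub_prod_le (below N y) hne T (fun p => (N p : ℝ)⁻¹) hx0
    (fun D _ => hav y hy.le D) hu1 hb1 hcardT R
  have e2 := norm_prod_one_add_sub_exp_le T (fun p => (N p : ℝ)⁻¹) hx0 hx1 hu1
  have hτL : |τ| = |s| / Real.sqrt L := by
    simp only [τ]
    rw [abs_div, abs_of_pos hsqrt]
  have b1 : C * (y ^ θ / y) * ((R + 2) * ((2 * C₁ + 1) * cutoff y) ^ (R + 1))
      ≤ C * Real.exp (-L) := by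
    rw [mul_assoc]
    gcongr
  have b2 : (1 / 2 : ℝ) ^ (R + 1) * Real.exp (2 * ‖u‖ * ∑ p ∈ T, (N p : ℝ)⁻¹)
      ≤ Real.exp (-(L / 2)) := by
    have g1 : (1 / 2 : ℝ) ^ (R + 1) ≤ Real.exp (-L) := by
      have hR : 2 * L ≤ R := Nat.le_ceil _
      have hl2 : 1 / 2 < Real.log 2 := by linarith [Real.log_two_gt_d9]
      rw [show (1 / 2 : ℝ) = Real.exp (-Real.log 2) by
        rw [Real.exp_neg, Real.exp_log (by norm_num)]; norm_num, ← Real.exp_nat_mul]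
      gcongr
      push_cast
      nlinarith
    have g2 : 2 * ‖u‖ * ∑ p ∈ T, (N p : ℝ)⁻¹ ≤ L / 2 := by
      calc 2 * ‖u‖ * ∑ p ∈ T, (N p : ℝ)⁻¹ ≤ 2 * |τ| * (2 * L) := by
            gcongr
            exact hS2
        _ = 4 * |s| * Real.sqrt L := by
            rw [hτL]
            field_simp
            rw [Real.sq_sqrt hL0.le]
            ring
        _ ≤ L / 2 := by
            have h8 : 8 * |s| ≤ Real.sqrt L := Real.le_sqrt_of_sq_le hLs
            nlinarith [Real.sq_sqrt hL0.le]
    calc _ ≤ Real.exp (-L) * Real.exp (L / 2) := by gcongr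
      _ = Real.exp (-(L / 2)) := by rw [← Real.exp_add]; congr 1; ring
  have b3 : ‖u‖ ^ 2 * ∑ p ∈ T, ((N p : ℝ)⁻¹) ^ 2 ≤ s ^ 2 / L * K := by
    calc ‖u‖ ^ 2 * ∑ p ∈ T, ((N p : ℝ)⁻¹) ^ 2 ≤ |τ| ^ 2 * K := by
          gcongr
          exact hsq T
      _ = s ^ 2 / L * K := by rw [hτL, div_pow, Real.sq_sqrt hL0.le, sq_abs]
  -- Centring contributes a factor of modulus 1, so the estimate for the uncentred average carries
  -- over.
  have hphase : charAverage N s y = ((∑ n ∈ below N y, (1 + u) ^ omegaOn T n) / (below N y).card)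
      * Complex.exp (-(Complex.I * τ * L)) := by
    rw [charAverage, div_mul_eq_mul_div, Finset.sum_mul]
    congr 1
    refine Finset.sum_congr rfl fun n _ => ?_
    rw [hu, ← Complex.exp_nat_mul, ← Complex.exp_add]
    congr 1
    simp only [τ]
    push_cast
    ring
  have hnorm1 : ‖Complex.exp (-(Complex.I * τ * L))‖ = 1 := by
    rw [show -(Complex.I * τ * L) = ((-(τ * L) : ℝ) : ℂ) * Complex.I by push_cast; ring,
      Complex.norm_exp_ofReal_mul_I]
  rw [hphase, sub_eq_add_neg (u * _), Complex.exp_add, ← sub_mul, norm_mul, hnorm1, mul_one]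
  have htri := norm_sub_le_norm_sub_add_norm_sub
    ((∑ n ∈ below N y, (1 + u) ^ omegaOn T n) / (below N y).card)
    (∏ p ∈ T, (1 + u * ((N p : ℝ)⁻¹ : ℝ))) (Complex.exp (u * recipSum N (cutoff y)))
  have e2' : ‖∏ p ∈ T, (1 + u * ((N p : ℝ)⁻¹ : ℝ)) - Complex.exp (u * recipSum N (cutoff y))‖
      ≤ ‖u‖ ^ 2 * ∑ p ∈ T, ((N p : ℝ)⁻¹) ^ 2 := e2
  linarith

lemma norm_exp_sub_quadratic_le {τ : ℝ} (hτ : |τ| ≤ 1) :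
    ‖Complex.exp (Complex.I * τ) - 1 - Complex.I * τ + τ ^ 2 / 2‖ ≤ |τ| ^ 3 := by
  have hn : ‖Complex.I * (τ : ℂ)‖ = |τ| := by simp
  have h1 := Complex.exp_bound (x := Complex.I * τ) (by rwa [hn]) (n := 3) (by norm_num)
  rw [hn] at h1
  have e : Complex.exp (Complex.I * τ) - ∑ m ∈ Finset.range 3, (Complex.I * τ) ^ m / m.factorial
      = Complex.exp (Complex.I * τ) - 1 - Complex.I * τ + τ ^ 2 / 2 := by
    simp only [Finset.sum_range_succ, Finset.sum_range_zero, Nat.factorial, mul_pow, Complex.I_sq]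
    push_cast
    ring
  rw [e] at h1
  refine h1.trans ?_
  have : 0 ≤ |τ| ^ 3 := by positivity
  norm_num [Nat.factorial]
  linarith

/-- The characteristic function of the normalised truncated prime divisor function converges to
that of the standard normal law. -/
lemma Regular.tendsto_charAverage (h : Regular N) (s : ℝ) :
    Tendsto (charAverage N s) atTop (𝓝 (Complex.exp (-(s ^ 2 / 2 : ℝ)))) := by
  have h0 := h.tendsto_charAverage_sub s
  have hS := h.tendsto_recipSum_cutoff_sub
  have hsqrt : Tendsto (fun y => Real.sqrt (loglog y)) atTop atTop :=
    Real.tendsto_sqrt_atTop.comp tendsto_loglog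
  have hτ : Tendsto (fun y => s / Real.sqrt (loglog y)) atTop (𝓝 0) := hsqrt.const_div_atTop s
  have hSL : Tendsto (fun y => recipSum N (cutoff y) / loglog y) atTop (𝓝 1) := by
    have := (hS.mul (hsqrt.const_div_atTop 1)).add_const 1
    simp only [mul_zero, zero_add] at this
    refine this.congr' ?_
    filter_upwards [tendsto_loglog.eventually_gt_atTop 0] with y hL
    have hq : 0 < Real.sqrt (loglog y) := Real.sqrt_pos.2 hL
    have hq2 := Real.mul_self_sqrt hL.le
    rw [div_mul_div_comm, hq2]
    field_simp
    ring
  have hexpo : Tendsto (fun y => (Complex.exp (Complex.I * ↑(s / Real.sqrt (loglog y))) - 1)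
      * recipSum N (cutoff y) - Complex.I * ↑(s / Real.sqrt (loglog y)) * loglog y) atTop
      (𝓝 (-(s ^ 2 / 2 : ℝ))) := by
    -- With `S` the truncated reciprocal sum, the exponent is `-τ²S/2 + iτ(S - L)` plus a remainder
    -- of size at most `|τ|³S`; the three limits are taken in this order.
    have m1 : Tendsto (fun y => ((-(s ^ 2 / 2) * (recipSum N (cutoff y) / loglog y) : ℝ) : ℂ))
        atTop (𝓝 ((-(s ^ 2 / 2) * 1 : ℝ) : ℂ)) :=
      (Complex.continuous_ofReal.tendsto _).comp (hSL.const_mul _)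
    have m2 : Tendsto (fun y => Complex.I * ((s * ((recipSum N (cutoff y) - loglog y)
        / Real.sqrt (loglog y)) : ℝ) : ℂ)) atTop (𝓝 (Complex.I * ((s * 0 : ℝ) : ℂ))) :=
      ((Complex.continuous_ofReal.tendsto _).comp (hS.const_mul s)).const_mul _
    have m3 : Tendsto (fun y => (Complex.exp (Complex.I * ↑(s / Real.sqrt (loglog y))) - 1
        - Complex.I * ↑(s / Real.sqrt (loglog y)) + (s / Real.sqrt (loglog y) : ℝ) ^ 2 / 2)
        * recipSum N (cutoff y)) atTop (𝓝 0) := by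
      have hb : Tendsto (fun y => |s / Real.sqrt (loglog y)| * s ^ 2
          * (recipSum N (cutoff y) / loglog y)) atTop (𝓝 0) := by
        simpa using (hτ.abs.mul_const (s ^ 2)).mul hSL
      refine squeeze_zero_norm' ?_ hb
      filter_upwards [tendsto_loglog.eventually_gt_atTop 0,
        hτ.abs.eventually_le_const (show |(0 : ℝ)| < 1 by simp)] with y hL hτ1
      have hS0 : 0 ≤ recipSum N (cutoff y) := Finset.sum_nonneg fun p _ => by positivity
      rw [norm_mul, Complex.norm_real, Real.norm_of_nonneg hS0]
      refine (mul_le_mul_of_nonneg_right (norm_exp_sub_quadratic_le hτ1) hS0).trans (le_of_eq ?_)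
      have : |s / Real.sqrt (loglog y)| ^ 2 = s ^ 2 / loglog y := by
        rw [sq_abs, div_pow, Real.sq_sqrt hL.le]
      rw [pow_succ', this]
      ring
    have m := (m1.add m2).add m3
    simp only [mul_one, mul_zero, Complex.ofReal_zero, add_zero] at m
    rw [Complex.ofReal_neg] at m
    refine m.congr' ?_
    filter_upwards [tendsto_loglog.eventually_gt_atTop 0] with y hL
    have hL' : (loglog y : ℂ) ≠ 0 := by exact_mod_cast hL.ne'
    have hq2 : ((Real.sqrt (loglog y) : ℝ) : ℂ) ^ 2 = loglog y := by
      exact_mod_cast Real.sq_sqrt hL.le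
    push_cast
    rw [div_pow, hq2]
    field_simp
    ring
  have h1 := h0.add ((Complex.continuous_exp.tendsto _).comp hexpo)
  rw [zero_add] at h1
  exact h1.congr fun y => by simp

end Characteristic

/-! ### Lévy's continuity theorem -/

section Levy

open MeasureTheory ProbabilityTheory

lemma gaussianReal_real_Iic (a : ℝ) : (gaussianReal 0 1).real (Set.Iic a) = Phi a := by
  rw [measureReal_def, gaussianReal_apply_eq_integral _ one_ne_zero,
    ENNReal.toReal_ofReal (integral_nonneg fun x => gaussianPDFReal_nonneg _ _ _), Phi,
    ← integral_const_mul]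
  simp [gaussianPDFReal_def]

lemma exists_uniform_law {α : Type*} (s : Finset α) (Z : α → ℝ) :
    ∃ μ : ProbabilityMeasure ℝ, s.Nonempty →
      (∀ t : ℝ, charFun (μ : Measure ℝ) t
        = (∑ n ∈ s, Complex.exp (t * (Z n : ℂ) * Complex.I)) / s.card) ∧
      ∀ a : ℝ, (μ : Measure ℝ).real (Set.Iic a) = ((s.filter fun n => Z n ≤ a).card : ℝ) / s.card := by
  rcases s.eq_empty_or_nonempty with rfl | hs
  -- An arbitrary law for the empty set, about which nothing is claimed; it lets a law be chosen for
  -- every index.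
  · exact ⟨⟨Measure.dirac 0, inferInstance⟩, fun h => absurd h (by simp)⟩
  have hc : (s.card : ENNReal) ≠ 0 := by exact_mod_cast hs.card_pos.ne'
  have hc' : (s.card : ENNReal) ≠ ⊤ := ENNReal.natCast_ne_top _
  set ν : Measure ℝ := (s.card : ENNReal)⁻¹ • ∑ n ∈ s, Measure.dirac (Z n)
  have hν : IsProbabilityMeasure ν := by
    constructor
    simp only [ν, Measure.smul_apply, Measure.finsetSum_apply, measure_univ, smul_eq_mul,
      Finset.sum_const, nsmul_eq_mul, mul_one]
    exact ENNReal.inv_mul_cancel hc hc'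
  refine ⟨⟨ν, hν⟩, fun _ => ⟨fun t => ?_, fun a => ?_⟩⟩
  · change charFun ν t = _
    rw [charFun_apply_real, integral_smul_measure, integral_finsetSum_measure]
    · simp only [integral_dirac, ENNReal.toReal_inv, ENNReal.toReal_natCast, Complex.real_smul]
      push_cast
      rw [div_eq_inv_mul]
    · intro n _
      exact integrable_dirac (by simp)
  · change ν.real _ = _
    rw [measureReal_def]
    simp only [ν, Measure.smul_apply, Measure.finsetSum_apply, smul_eq_mul,
      Measure.dirac_apply' _ measurableSet_Iic, ENNReal.toReal_mul, ENNReal.toReal_inv,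
      ENNReal.toReal_natCast]
    rw [div_eq_inv_mul, Finset.card_filter, ENNReal.toReal_sum]
    · push_cast
      congr 1
      refine Finset.sum_congr rfl fun n _ => ?_
      by_cases h : Z n ≤ a <;> simp [h]
    · intro n _
      by_cases h : Z n ≤ a <;> simp [h]

/-- A form of Lévy's continuity theorem for uniform distributions on finite sets. -/
lemma tendsto_card_filter_le_of_tendsto_charFun {α : Type*} {Ω : ℝ → Finset α}
    (hΩ : ∀ᶠ y in atTop, (Ω y).Nonempty) {Z : ℝ → α → ℝ}
    (h : ∀ t : ℝ, Tendsto (fun y => (∑ n ∈ Ω y, Complex.exp (t * (Z y n : ℂ) * Complex.I))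
      / (Ω y).card) atTop (𝓝 (Complex.exp (-(t ^ 2 / 2 : ℝ))))) (a : ℝ) :
    Tendsto (fun y => (((Ω y).filter fun n => Z y n ≤ a).card : ℝ) / (Ω y).card) atTop
      (𝓝 (Phi a)) := by
  refine tendsto_of_seq_tendsto fun y hy => ?_
  choose μ hμ using fun j => exists_uniform_law (Ω (y j)) (Z (y j))
  have hne := hy.eventually hΩ
  set γ : ProbabilityMeasure ℝ := ⟨gaussianReal 0 1, inferInstance⟩
  have hlim : Tendsto μ atTop (𝓝 γ) := by
    refine ProbabilityMeasure.tendsto_of_tendsto_charFun fun t => ?_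
    have e : charFun (γ : Measure ℝ) t = Complex.exp (-(t ^ 2 / 2 : ℝ)) := by
      change charFun (gaussianReal 0 1) t = _
      rw [charFun_gaussianReal]
      congr 1
      push_cast
      ring
    rw [e]
    refine ((h t).comp hy).congr' ?_
    filter_upwards [hne] with j hj
    rw [(hμ j hj).1 t]
    rfl
  -- The Gaussian has no atom at `a`, so weak convergence gives convergence on the half-line.
  have hfr : (γ : Measure ℝ) (frontier (Set.Iic a)) = 0 := by
    rw [frontier_Iic]
    have : NullSingletonClass (γ : Measure ℝ) := nullSingletonClass_gaussianReal one_ne_zero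
    exact measure_singleton a
  have h1 := ProbabilityMeasure.tendsto_measure_of_null_frontier_of_tendsto' hlim hfr
  have h2 := (ENNReal.tendsto_toReal (measure_ne_top _ _)).comp h1
  have e : ((γ : Measure ℝ) (Set.Iic a)).toReal = Phi a := gaussianReal_real_Iic a
  rw [e] at h2
  refine h2.congr' ?_
  filter_upwards [hne] with j hj
  exact (hμ j hj).2 a

end Levy

/-! ### Comparing the exact count with the truncated one -/

section Comparison

variable {P : Type*} {N : P → ℕ}

/-- A generator with `n p = 1` and `e p = 0` has multiplicity exactly `k`. The two counts can
therefore disagree only at generators in `e`, with `n p ≥ 2`, or occurring in `n` outside `T`. -/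
lemma abs_omegaExact_sub_le [DecidableEq P] (k : ℕ) (e n : FreeMonoidOn P) (T Q : Finset P)
    (hk : 1 ≤ k) (hQ : n.support ⊆ Q) :
    |(omegaExact k (k • n + e) : ℝ) - omegaOn T n| ≤ e.support.card
      + (Q.filter fun p => 2 ≤ n p).card
      + ((Q \ T).filter fun p => n p ≠ 0).card := by
  set A := (k • n + e).support.filter fun p => (k • n + e) p = k
  set B := T.filter fun p => n p ≠ 0
  set E := e.support ∪ Q.filter (fun p => 2 ≤ n p) ∪ (Q \ T).filter (fun p => n p ≠ 0)
  have hE : E.card ≤ e.support.card + (Q.filter fun p => 2 ≤ n p).card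
      + ((Q \ T).filter fun p => n p ≠ 0).card :=
    (Finset.card_union_le _ _).trans (by gcongr; exact Finset.card_union_le _ _)
  have hval : ∀ p, (k • n + e) p = k * n p + e p := fun p => by simp
  have hsupp : ∀ p, n p ≠ 0 → p ∈ Q := fun p hp => hQ (Finsupp.mem_support_iff.2 hp)
  have hAB : A ⊆ B ∪ E := by
    intro p hp
    have h1 := (Finset.mem_filter.1 hp).2
    rw [hval] at h1
    simp only [B, E, Finset.mem_union, Finset.mem_filter, Finset.mem_sdiff,
      Finsupp.mem_support_iff]
    by_cases hn : n p = 0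
    · rw [hn] at h1
      right; left; left
      omega
    · have := hsupp p hn
      tauto
  have hBA : B ⊆ A ∪ E := by
    intro p hp
    obtain ⟨h1, h2⟩ := Finset.mem_filter.1 hp
    simp only [A, E, Finset.mem_union, Finset.mem_filter, Finsupp.mem_support_iff, hval]
    by_cases h3 : 2 ≤ n p
    · exact Or.inr (Or.inl (Or.inr ⟨hsupp p h2, h3⟩))
    · have h4 : n p = 1 := by omega
      by_cases h5 : e p = 0
      · left
        rw [h4, h5]
        omega
      · exact Or.inr (Or.inl (Or.inl h5))
  have c1 : A.card ≤ B.card + E.card := (Finset.card_le_card hAB).trans (Finset.card_union_le _ _)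
  have c2 : B.card ≤ A.card + E.card := (Finset.card_le_card hBA).trans (Finset.card_union_le _ _)
  have hE' : (E.card : ℝ) ≤ e.support.card + (Q.filter fun p => 2 ≤ n p).card
      + ((Q \ T).filter fun p => n p ≠ 0).card := by exact_mod_cast hE
  have c1' : (A.card : ℝ) ≤ B.card + E.card := by exact_mod_cast c1
  have c2' : (B.card : ℝ) ≤ A.card + E.card := by exact_mod_cast c2
  change |(A.card : ℝ) - B.card| ≤ _
  rw [abs_le]
  constructor <;> linarith

/-- Removing `j` copies of `p` injects into the elements of norm at most `y / N(p)^j`. The bound has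
no additive error, so it can be summed over all generators up to `y`, unlike the level of
distribution. -/
lemma Regular.card_filter_dvd_le (h : Regular N) : ∃ C : ℝ, 0 < C ∧ ∀ y : ℝ, 1 ≤ y →
    ∀ (p : P) (j : ℕ), (((below N y).filter fun n => j ≤ n p).card : ℝ) / (below N y).card
      ≤ C * ((N p : ℝ)⁻¹) ^ j := by
  classical
  obtain ⟨C, hC, hup⟩ := h.upper
  obtain ⟨c, hc, hlo⟩ := h.lower
  refine ⟨C / c, by positivity, fun y hy p j => ?_⟩
  have hp0 : (0 : ℝ) < (N p : ℝ) ^ j := by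
    have := h.one_lt p
    positivity
  have h1 : ((below N y).filter fun n => j ≤ n p).card ≤ (below N (y / (N p : ℝ) ^ j)).card := by
    have hcancel : ∀ n : FreeMonoidOn P, j ≤ n p →
        n - Finsupp.single p j + Finsupp.single p j = n := fun n hn =>
      tsub_add_cancel_of_le (Finsupp.single_le_iff.2 hn)
    refine Finset.card_le_card_of_injOn (fun n => n - Finsupp.single p j) (fun n hn => ?_)
      fun n hn n' hn' hnn => ?_
    · obtain ⟨h2, h3⟩ := Finset.mem_filter.1 hn
      rw [h.mem_below, ← hcancel n h3, monoidNorm_add, monoidNorm_single] at h2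
      rw [Finset.mem_coe, h.mem_below, le_div_iff₀ hp0]
      exact_mod_cast h2
    · rw [← hcancel n (Finset.mem_filter.1 hn).2, ← hcancel n' (Finset.mem_filter.1 hn').2]
      simp only at hnn
      rw [hnn]
  have h2 := hlo y hy
  have h3 := hup (y / (N p : ℝ) ^ j) (by positivity)
  calc (((below N y).filter fun n => j ≤ n p).card : ℝ) / (below N y).card
      ≤ (C * (y / (N p : ℝ) ^ j)) / (c * y) := by
        gcongr
        exact le_trans (by exact_mod_cast h1) h3
    _ = C / c * ((N p : ℝ)⁻¹) ^ j := by
        rw [inv_pow]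
        field_simp

lemma average_card_filter {α : Type*} (Ω : Finset α) (Q : Finset P) (r : α → P → Prop)
    [∀ n p, Decidable (r n p)] (F : ℝ) :
    (∑ n ∈ Ω, ((Q.filter fun p => r n p).card : ℝ)) / F
      = ∑ p ∈ Q, ((Ω.filter fun n => r n p).card : ℝ) / F := by
  rw [← Finset.sum_div]
  congr 1
  simp only [Finset.card_filter]
  push_cast
  exact Finset.sum_comm

lemma Regular.tendsto_card_below_sqrt (h : Regular N) :
    Tendsto (fun y => ((below N (Real.sqrt y)).card : ℝ) / (below N y).card) atTop (𝓝 0) := by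
  obtain ⟨C, hC, hup⟩ := h.upper
  obtain ⟨c, hc, hlo⟩ := h.lower
  refine squeeze_zero' (Eventually.of_forall fun y => by positivity) ?_
    (Real.tendsto_sqrt_atTop.const_div_atTop (C / c))
  filter_upwards [eventually_ge_atTop 1] with y hy
  have hs : 0 < Real.sqrt y := Real.sqrt_pos.2 (by linarith)
  calc ((below N (Real.sqrt y)).card : ℝ) / (below N y).card
      ≤ (C * Real.sqrt y) / (c * y) := by
        gcongr
        · exact hup _ hs.le
        · exact hlo y hy
    _ = C / c / Real.sqrt y := by
        nth_rewrite 2 [← Real.mul_self_sqrt (show 0 ≤ y by linarith)]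
        field_simp

lemma abs_sqrt_sub_sqrt_le {x y : ℝ} (hx : 0 ≤ x) (hy : 1 ≤ y) :
    |Real.sqrt x - Real.sqrt y| ≤ |x - y| := by
  have hsy : 1 ≤ Real.sqrt y := Real.one_le_sqrt.2 hy
  have e : x - y = (Real.sqrt x - Real.sqrt y) * (Real.sqrt x + Real.sqrt y) := by
    nlinarith [Real.mul_self_sqrt hx, Real.mul_self_sqrt (show 0 ≤ y by linarith)]
  rw [e, abs_mul, abs_of_nonneg (show 0 ≤ Real.sqrt x + Real.sqrt y by positivity)]
  exact le_mul_of_one_le_right (abs_nonneg _) (by linarith [Real.sqrt_nonneg x])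

/-- For `n` between `√y` and `y`, the iterated logarithms of the norms of `k • n + e` and of `y`
are within a bounded distance. -/
lemma abs_loglog_monoidNorm_sub_le (hN : ∀ p, 1 < N p) {k : ℕ} (hk : 1 ≤ k)
    (e : FreeMonoidOn P) : ∃ C : ℝ, 0 ≤ C ∧ ∀ y : ℝ, Real.exp 1 ≤ y → ∀ n : FreeMonoidOn P,
      Real.sqrt y < monoidNorm N n → (monoidNorm N n : ℝ) ≤ y →
      |loglog (monoidNorm N (k • n + e)) - loglog y| ≤ C := by
  have hk1 : (1 : ℝ) ≤ k := by exact_mod_cast hk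
  have he1 := one_le_monoidNorm hN e
  have hle : 0 ≤ Real.log (monoidNorm N e) := Real.log_nonneg he1
  set A : ℝ := k + Real.log (monoidNorm N e)
  have hA : 1 ≤ A := by linarith
  have hlA := Real.log_nonneg hA
  have hl2 := Real.log_nonneg (show (1 : ℝ) ≤ 2 by norm_num)
  refine ⟨Real.log 2 + Real.log A, by positivity, fun y hy n hn hny => ?_⟩
  have hy0 : 0 < y := (Real.exp_pos 1).trans_le hy
  have hly : 1 ≤ Real.log y := (Real.le_log_iff_exp_le hy0).2 hy
  have hn0 : (0 : ℝ) < monoidNorm N n := (Real.sqrt_nonneg y).trans_lt hn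
  have hm : Real.log (monoidNorm N (k • n + e))
      = k * Real.log (monoidNorm N n) + Real.log (monoidNorm N e) := by
    rw [monoidNorm_add, monoidNorm_nsmul]
    push_cast
    rw [Real.log_mul (by positivity) (by positivity), Real.log_pow]
  have h1 : Real.log y / 2 ≤ Real.log (monoidNorm N n) := by
    rw [← Real.log_sqrt hy0.le]
    exact Real.log_le_log (Real.sqrt_pos.2 hy0) hn.le
  have h2 : Real.log (monoidNorm N n) ≤ Real.log y := Real.log_le_log hn0 hny
  have h3 : Real.log y / 2 ≤ Real.log (monoidNorm N (k • n + e)) := by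
    rw [hm]
    nlinarith
  have h4 : Real.log (monoidNorm N (k • n + e)) ≤ A * Real.log y := by
    rw [hm]
    simp only [A]
    nlinarith
  have h5 : loglog y - Real.log 2 ≤ loglog (monoidNorm N (k • n + e)) := by
    rw [loglog, ← Real.log_div (by positivity) (by norm_num)]
    exact Real.log_le_log (by positivity) h3
  have h6 : loglog (monoidNorm N (k • n + e)) ≤ Real.log A + loglog y := by
    rw [loglog, loglog, ← Real.log_mul (by positivity) (by positivity)]
    exact Real.log_le_log (by linarith) h4
  rw [abs_le]
  constructor <;> linarith

lemma norm_exp_sub_exp_le (s x y : ℝ) :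
    ‖Complex.exp (s * (x : ℂ) * Complex.I) - Complex.exp (s * (y : ℂ) * Complex.I)‖
      ≤ |s| * |x - y| := by
  have e : Complex.exp (s * (x : ℂ) * Complex.I) - Complex.exp (s * (y : ℂ) * Complex.I)
      = Complex.exp ((s * y : ℝ) * Complex.I)
        * (Complex.exp (Complex.I * ((s * (x - y) : ℝ) : ℂ)) - 1) := by
    rw [mul_sub, ← Complex.exp_add, mul_one]
    congr 1
    · congr 1
      push_cast
      ring
    · congr 1
      push_cast
      ring
  rw [e, norm_mul, Complex.norm_exp_ofReal_mul_I, one_mul, ← abs_mul]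
  exact Real.norm_exp_I_mul_ofReal_sub_one_le

lemma norm_exp_sub_exp_le_two (s x y : ℝ) :
    ‖Complex.exp (s * (x : ℂ) * Complex.I) - Complex.exp (s * (y : ℂ) * Complex.I)‖ ≤ 2 := by
  refine (norm_sub_le _ _).trans ?_
  rw [← Complex.ofReal_mul, ← Complex.ofReal_mul, Complex.norm_exp_ofReal_mul_I,
    Complex.norm_exp_ofReal_mul_I]
  norm_num

end Comparison

/-! ### The limit law on a fixed fibre -/

section Component

variable {P : Type*} {N : P → ℕ}

/-- The additive function `omegaExact k` at `k • n + e`, centred at the iterated logarithm of the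
norm, but normalised by a quantity depending on `y` only. It is at most `a` precisely when the
exactly normalised one is. -/
noncomputable def recentred (N : P → ℕ) (k : ℕ) (e : FreeMonoidOn P) (a y : ℝ)
    (n : FreeMonoidOn P) : ℝ :=
  (omegaExact k (k • n + e) - loglog (monoidNorm N (k • n + e))
    - a * (Real.sqrt (loglog (monoidNorm N (k • n + e))) - Real.sqrt (loglog y)))
    / Real.sqrt (loglog y)

/-- The average number of generators that account for the difference between
`omegaExact k (k • n + e)` and the truncated count is small. -/
lemma Regular.average_exceptional_le [DecidableEq P] (h : Regular N) :
    ∃ C : ℝ, 0 < C ∧ ∀ᶠ y : ℝ in atTop,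
      (∑ n ∈ below N y, (((gensBelow N y).filter fun p => 2 ≤ n p).card
        + ((gensBelow N y \ gensBelow N (cutoff y)).filter fun p => n p ≠ 0).card : ℝ))
        / (below N y).card ≤ C * (1 + |recipSum N y - recipSum N (cutoff y)|) := by
  obtain ⟨C, hC, hdvd⟩ := h.card_filter_dvd_le
  obtain ⟨K, hK, hsq⟩ := h.sum_gens_sq_le
  refine ⟨C * (K + 1), by positivity, ?_⟩
  filter_upwards [eventually_gt_atTop 1, tendsto_loglog.eventually_ge_atTop 1] with y hy hL
  have hcut : cutoff y ≤ y := by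
    nth_rewrite 2 [← Real.exp_log (show 0 < y by linarith)]
    refine Real.exp_le_exp.2 (div_le_self (Real.log_pos hy).le ?_)
    nlinarith
  have hsub : gensBelow N (cutoff y) ⊆ gensBelow N y := by
    intro p hp
    rw [h.mem_gensBelow] at hp ⊢
    exact hp.trans hcut
  rw [Finset.sum_add_distrib, add_div, average_card_filter, average_card_filter]
  have h1 : ∑ p ∈ gensBelow N y, (((below N y).filter fun n => 2 ≤ n p).card : ℝ)
      / (below N y).card ≤ C * K := by
    calc _ ≤ ∑ p ∈ gensBelow N y, C * ((N p : ℝ)⁻¹) ^ 2 :=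
          Finset.sum_le_sum fun p _ => hdvd y hy.le p 2
      _ = C * ∑ p ∈ gensBelow N y, ((N p : ℝ)⁻¹) ^ 2 := by rw [Finset.mul_sum]
      _ ≤ C * K := by gcongr; exact hsq _
  have h2 : ∑ p ∈ gensBelow N y \ gensBelow N (cutoff y),
      (((below N y).filter fun n => n p ≠ 0).card : ℝ) / (below N y).card
        ≤ C * |recipSum N y - recipSum N (cutoff y)| := by
    calc _ ≤ ∑ p ∈ gensBelow N y \ gensBelow N (cutoff y), C * (N p : ℝ)⁻¹ := by
          refine Finset.sum_le_sum fun p _ => ?_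
          have := hdvd y hy.le p 1
          simpa only [Nat.one_le_iff_ne_zero, pow_one] using this
      _ = C * (recipSum N y - recipSum N (cutoff y)) := by
          rw [← Finset.mul_sum, recipSum, recipSum, ← Finset.sum_sdiff hsub, add_sub_cancel_right]
      _ ≤ _ := by gcongr; exact le_abs_self _
  have h3 := abs_nonneg (recipSum N y - recipSum N (cutoff y))
  have h4 : 0 ≤ C * K * |recipSum N y - recipSum N (cutoff y)| := by positivity
  nlinarith

/-- Outside the negligible set `N(n) ≤ √y`, the recentred and truncated variables differ by a
bounded quantity plus the exceptional generators, divided by `√L`. As `exp(isx)` is Lipschitz, small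
average difference suffices; no second moment is needed. -/
lemma Regular.tendsto_charFun_recentred (h : Regular N) {k : ℕ} (hk : 1 ≤ k) (e : FreeMonoidOn P)
    (a s : ℝ) :
    Tendsto (fun y => (∑ n ∈ below N y,
      Complex.exp (s * (recentred N k e a y n : ℂ) * Complex.I)) / (below N y).card) atTop
      (𝓝 (Complex.exp (-(s ^ 2 / 2 : ℝ)))) := by
  classical
  obtain ⟨C₀, hC₀, hll⟩ := abs_loglog_monoidNorm_sub_le h.one_lt hk e
  obtain ⟨C₁, hC₁, hexc⟩ := h.average_exceptional_le
  have hsqrt : Tendsto (fun y => Real.sqrt (loglog y)) atTop atTop :=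
    Real.tendsto_sqrt_atTop.comp tendsto_loglog
  set B : ℝ := e.support.card + C₀ * (1 + |a|)
  have hbound : Tendsto (fun y => 2 * (((below N (Real.sqrt y)).card : ℝ) / (below N y).card)
      + |s| * (B / Real.sqrt (loglog y) + C₁ * (1 / Real.sqrt (loglog y)
        + |(recipSum N y - loglog y) / Real.sqrt (loglog y)
          - (recipSum N (cutoff y) - loglog y) / Real.sqrt (loglog y)|))) atTop (𝓝 0) := by
    have t1 := h.tendsto_card_below_sqrt.const_mul 2
    have t2 := (h.tendsto_recipSum_sub.sub h.tendsto_recipSum_cutoff_sub).abs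
    have t3 := (((hsqrt.const_div_atTop 1).add t2).const_mul C₁)
    have t4 := ((hsqrt.const_div_atTop B).add t3).const_mul |s|
    simpa using t1.add t4
  have key := h.tendsto_charAverage s
  rw [← tendsto_sub_nhds_zero_iff] at key ⊢
  suffices hd : Tendsto (fun y => (∑ n ∈ below N y,
      Complex.exp (s * (recentred N k e a y n : ℂ) * Complex.I)) / (below N y).card
      - charAverage N s y) atTop (𝓝 0) by
    simpa using hd.add key
  refine squeeze_zero_norm' ?_ hbound
  filter_upwards [hexc, eventually_ge_atTop (Real.exp 1), tendsto_loglog.eventually_ge_atTop 1]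
    with y hexc hy hL
  have hy0 : 0 < y := (Real.exp_pos 1).trans_le hy
  have hy1 : 1 ≤ y := by linarith [Real.add_one_le_exp 1]
  set L := loglog y
  have hq : 0 < Real.sqrt L := Real.sqrt_pos.2 (by linarith)
  set T := gensBelow N (cutoff y)
  set Q := gensBelow N y
  set F : ℝ := ((below N y).card : ℝ)
  have hF : 0 < F := by
    have : (0 : FreeMonoidOn P) ∈ below N y := by
      rw [h.mem_below]
      simpa [monoidNorm_zero] using hy1
    exact Nat.cast_pos.2 (Finset.card_pos.2 ⟨_, this⟩)
  set w : FreeMonoidOn P → ℝ := fun n => ((Q.filter fun p => 2 ≤ n p).card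
        + ((Q \ T).filter fun p => n p ≠ 0).card : ℝ)
  set bad : FreeMonoidOn P → ℝ := fun n => if n ∈ below N (Real.sqrt y) then 1 else 0
  have hpt : ∀ n ∈ below N y,
      ‖Complex.exp (s * (recentred N k e a y n : ℂ) * Complex.I)
        - Complex.exp (s * (((omegaOn T n - L) / Real.sqrt L : ℝ) : ℂ) * Complex.I)‖
      ≤ 2 * bad n + |s| * ((B + w n) / Real.sqrt L) := by
    intro n hn
    have hw : 0 ≤ w n := by positivity
    by_cases hb : n ∈ below N (Real.sqrt y)
    · refine (norm_exp_sub_exp_le_two _ _ _).trans ?_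
      simp only [bad, if_pos hb]
      have : 0 ≤ |s| * ((B + w n) / Real.sqrt L) := by positivity
      linarith
    · refine (norm_exp_sub_exp_le _ _ _).trans ?_
      simp only [bad, if_neg hb, mul_zero, zero_add]
      gcongr
      rw [h.mem_below, not_le] at hb
      have hny := h.mem_below.1 hn
      have hLn := hll y hy n hb hny
      have hsupp : n.support ⊆ Q := by
        intro p hp
        rw [h.mem_gensBelow]
        refine le_trans ?_ hny
        exact_mod_cast le_monoidNorm_of_mem_support h.one_lt hp
      have hom := abs_omegaExact_sub_le k e n T Q hk hsupp
      rw [recentred, ← sub_div, abs_div, abs_of_pos hq]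
      gcongr
      set Ln := loglog (monoidNorm N (k • n + e))
      -- A negative `Ln` has square root 0 by convention; then `√L ≤ L ≤ L - Ln ≤ C₀` still holds.
      have hsq : |Real.sqrt Ln - Real.sqrt L| ≤ C₀ := by
        rcases le_or_gt 0 Ln with h0 | h0
        · exact (abs_sqrt_sub_sqrt_le h0 hL).trans hLn
        · rw [Real.sqrt_eq_zero_of_nonpos h0.le, zero_sub, abs_neg, abs_of_pos hq]
          have : Real.sqrt L ≤ L := by
            rw [Real.sqrt_le_left (by linarith)]
            nlinarith
          have := (abs_le.1 hLn).1
          linarith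
      have e1 : (omegaExact k (k • n + e) : ℝ) - Ln - a * (Real.sqrt Ln - Real.sqrt L)
          - (omegaOn T n - L) = (omegaExact k (k • n + e) - omegaOn T n) - (Ln - L)
            - a * (Real.sqrt Ln - Real.sqrt L) := by ring
      have e2 : |a * (Real.sqrt Ln - Real.sqrt L)| ≤ |a| * C₀ := by
        rw [abs_mul]
        gcongr
      rw [e1]
      refine (abs_sub _ _).trans ((add_le_add (abs_sub _ _) e2).trans ?_)
      simp only [B, w]
      linarith
  have havg : ‖(∑ n ∈ below N y, Complex.exp (s * (recentred N k e a y n : ℂ) * Complex.I)) / (below N y).card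
      - charAverage N s y‖ ≤ (∑ n ∈ below N y, (2 * bad n + |s| * ((B + w n) / Real.sqrt L))) / F := by
    have e1 : (∑ n ∈ below N y, Complex.exp (s * (recentred N k e a y n : ℂ) * Complex.I)) / (below N y).card
      - charAverage N s y = (∑ n ∈ below N y,
        (Complex.exp (s * (recentred N k e a y n : ℂ) * Complex.I)
        - Complex.exp (s * (((omegaOn T n - L) / Real.sqrt L : ℝ) : ℂ) * Complex.I)))
          / (below N y).card := by
      rw [Finset.sum_sub_distrib, sub_div]
      rfl
    rw [e1, norm_div, Complex.norm_natCast]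
    gcongr
    exact (norm_sum_le _ _).trans (Finset.sum_le_sum hpt)
  refine havg.trans ?_
  have hbadsum : (∑ n ∈ below N y, bad n) ≤ (below N (Real.sqrt y)).card := by
    simp only [bad]
    rw [Finset.sum_ite_mem, Finset.sum_const, nsmul_eq_mul, mul_one]
    exact_mod_cast Finset.card_le_card Finset.inter_subset_right
  have esum : (∑ n ∈ below N y, (2 * bad n + |s| * ((B + w n) / Real.sqrt L))) / F
      = 2 * ((∑ n ∈ below N y, bad n) / F)
        + |s| * (B / Real.sqrt L + ((∑ n ∈ below N y, w n) / F) / Real.sqrt L) := by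
    rw [Finset.sum_add_distrib, ← Finset.mul_sum, ← Finset.mul_sum, ← Finset.sum_div,
      Finset.sum_add_distrib, Finset.sum_const, nsmul_eq_mul]
    change (2 * _ + |s| * ((F * B + _) / _)) / F = _
    field_simp
  rw [esum]
  have eS : C₁ * (1 / Real.sqrt L + |(recipSum N y - L) / Real.sqrt L
      - (recipSum N (cutoff y) - L) / Real.sqrt L|)
      = C₁ * (1 + |recipSum N y - recipSum N (cutoff y)|) / Real.sqrt L := by
    rw [← sub_div, abs_div, abs_of_pos hq, sub_sub_sub_cancel_right, ← add_div, mul_div_assoc]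
  rw [eS]
  gcongr

/-- The Erdős–Kac theorem along the elements `k • n + e` for fixed `e`. -/
lemma Regular.tendsto_card_component (h : Regular N) {k : ℕ} (hk : 1 ≤ k) (e : FreeMonoidOn P)
    (a : ℝ) :
    Tendsto (fun y => (((below N y).filter fun n => 3 ≤ monoidNorm N (k • n + e) ∧
        ((omegaExact k (k • n + e) : ℝ) - Real.log (Real.log (monoidNorm N (k • n + e))))
          / Real.sqrt (Real.log (Real.log (monoidNorm N (k • n + e)))) ≤ a).card : ℝ)
        / (below N y).card) atTop (𝓝 (Phi a)) := by
  classical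
  have hne : ∀ᶠ y in atTop, (below N y).Nonempty := by
    filter_upwards [eventually_ge_atTop 1] with y hy
    exact ⟨0, h.mem_below.2 (by simpa [monoidNorm_zero] using hy)⟩
  have h1 := tendsto_card_filter_le_of_tendsto_charFun hne
    (h.tendsto_charFun_recentred hk e a) a
  have h0 := h.tendsto_card_below_sqrt
  obtain ⟨C₀, hC₀, hll⟩ := abs_loglog_monoidNorm_sub_le h.one_lt hk e
  rw [← tendsto_sub_nhds_zero_iff] at h1 ⊢
  refine (add_zero (0 : ℝ) ▸ h1.add (squeeze_zero_norm' (f := fun y =>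
    (((below N y).filter fun n => 3 ≤ monoidNorm N (k • n + e) ∧
        ((omegaExact k (k • n + e) : ℝ) - Real.log (Real.log (monoidNorm N (k • n + e))))
          / Real.sqrt (Real.log (Real.log (monoidNorm N (k • n + e)))) ≤ a).card : ℝ)
        / (below N y).card
      - (((below N y).filter fun n => recentred N k e a y n ≤ a).card : ℝ) / (below N y).card)
    ?_ h0)).congr fun y => by ring
  filter_upwards [eventually_ge_atTop (Real.exp 1), eventually_ge_atTop 9,
    tendsto_loglog.eventually_gt_atTop C₀] with y hy hy9 hL
  have hL0 : 0 < loglog y := hC₀.trans_lt hL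
  have hq : 0 < Real.sqrt (loglog y) := Real.sqrt_pos.2 hL0
  set A := (below N y).filter fun n => 3 ≤ monoidNorm N (k • n + e) ∧
        ((omegaExact k (k • n + e) : ℝ) - Real.log (Real.log (monoidNorm N (k • n + e))))
          / Real.sqrt (Real.log (Real.log (monoidNorm N (k • n + e)))) ≤ a
  set B := (below N y).filter fun n => recentred N k e a y n ≤ a
  set E := below N (Real.sqrt y)
  have hiff : ∀ n ∈ below N y, n ∉ E → (n ∈ A ↔ n ∈ B) := by
    intro n hn hE
    rw [h.mem_below, not_le] at hE
    have hLn := (abs_le.1 (hll y hy n hE (h.mem_below.1 hn))).1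
    have hLn0 : 0 < loglog (monoidNorm N (k • n + e)) := by linarith
    have hqn := Real.sqrt_pos.2 hLn0
    have h3 : 3 ≤ monoidNorm N (k • n + e) := by
      have h3' : (3 : ℝ) ≤ monoidNorm N n := by
        refine le_trans (Real.le_sqrt_of_sq_le ?_) hE.le
        norm_num
        exact hy9
      have h3n : 3 ≤ monoidNorm N n := by exact_mod_cast h3'
      rw [monoidNorm_add, monoidNorm_nsmul]
      calc 3 ≤ monoidNorm N n := h3n
        _ ≤ monoidNorm N n ^ k := Nat.le_self_pow (by omega) _
        _ ≤ _ := Nat.le_mul_of_pos_right _ (monoidNorm_pos h.one_lt e)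
    simp only [A, B, Finset.mem_filter, hn, true_and, h3]
    rw [recentred]
    change (_ - loglog (monoidNorm N (k • n + e))) / Real.sqrt (loglog (monoidNorm N (k • n + e)))
      ≤ a ↔ _
    -- Once denominators are cleared, both conditions read `ω_k - Ln ≤ a√Ln`, the term `a√L`
    -- cancelling.
    rw [div_le_iff₀ hqn, div_le_iff₀ hq]
    constructor <;> intro h <;> linarith
  have hAB : A ⊆ B ∪ E := by
    intro n hn
    by_cases hE : n ∈ E
    · exact Finset.mem_union_right _ hE
    · exact Finset.mem_union_left _ ((hiff n (Finset.mem_filter.1 hn).1 hE).1 hn)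
  have hBA : B ⊆ A ∪ E := by
    intro n hn
    by_cases hE : n ∈ E
    · exact Finset.mem_union_right _ hE
    · exact Finset.mem_union_left _ ((hiff n (Finset.mem_filter.1 hn).1 hE).2 hn)
  have c1 : (A.card : ℝ) ≤ B.card + E.card := by
    exact_mod_cast (Finset.card_le_card hAB).trans (Finset.card_union_le _ _)
  have c2 : (B.card : ℝ) ≤ A.card + E.card := by
    exact_mod_cast (Finset.card_le_card hBA).trans (Finset.card_union_le _ _)
  rw [← sub_div, Real.norm_eq_abs, abs_div,
    abs_of_nonneg (show (0 : ℝ) ≤ ((below N y).card : ℝ) from Nat.cast_nonneg _)]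
  gcongr
  rw [abs_le]
  constructor <;> linarith

end Component

/-! ### Decomposing `k`-full elements and summing over fibres -/

section Decomposition

variable {P : Type*} {N : P → ℕ}

/-- Every multiplicity is zero or strictly between `k` and `2 * k`. Each `k`-full element is
uniquely `k • n + e` with `e` of this kind. -/
def IsRemainder (k : ℕ) (e : FreeMonoidOn P) : Prop :=
  ∀ p, e p = 0 ∨ (k < e p ∧ e p < 2 * k)

lemma isFull_nsmul_add {k : ℕ} (n : FreeMonoidOn P) {e : FreeMonoidOn P} (he : IsRemainder k e) :
    IsFull k (k • n + e) := by
  intro p hp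
  simp only [Finsupp.coe_add, Finsupp.coe_smul, Pi.add_apply, Pi.smul_apply, smul_eq_mul] at hp ⊢
  rcases he p with h0 | h0
  · rw [h0, add_zero] at hp ⊢
    exact Nat.le_mul_of_pos_right _ (Nat.pos_of_ne_zero (right_ne_zero_of_mul hp))
  · exact h0.1.le.trans (Nat.le_add_left _ _)

lemma exists_eq_nsmul_add {k : ℕ} (hk : 1 ≤ k) {m : FreeMonoidOn P} (hm : IsFull k m) :
    ∃ n e : FreeMonoidOn P, IsRemainder k e ∧ m = k • n + e := by
  have hk0 : 0 < k := hk
  -- When `k` does not divide a multiplicity, one unit of the quotient moves to the remainder,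
  -- placing it strictly between `k` and `2k`; fullness makes the quotient positive.
  refine ⟨m.mapRange (fun j => if k ∣ j then j / k else j / k - 1) (by simp),
    m.mapRange (fun j => if k ∣ j then 0 else k + j % k) (by simp), fun p => ?_, ?_⟩
  · simp only [Finsupp.mapRange_apply]
    split_ifs with h
    · exact Or.inl rfl
    · have h1 := Nat.mod_lt (m p) hk0
      have h2 : m p % k ≠ 0 := fun h3 => h (Nat.dvd_of_mod_eq_zero h3)
      right
      omega
  · ext p
    simp only [Finsupp.coe_add, Finsupp.coe_smul, Pi.add_apply, Pi.smul_apply, smul_eq_mul,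
      Finsupp.mapRange_apply]
    split_ifs with h
    · rw [Nat.mul_div_cancel' h, add_zero]
    · have h0 : m p ≠ 0 := fun h0 => h (h0 ▸ dvd_zero k)
      have h1 : 1 ≤ m p / k := (Nat.one_le_div_iff hk0).2 (hm p h0)
      have h2 := Nat.div_add_mod (m p) k
      obtain ⟨q, hq⟩ := Nat.exists_eq_add_of_le h1
      rw [hq] at h2 ⊢
      rw [Nat.add_sub_cancel_left]
      linarith

/-- A remainder is determined by its residues modulo `k`, which gives uniqueness of the
decomposition. -/
lemma IsRemainder.eq_ite {k : ℕ} {e : FreeMonoidOn P} (he : IsRemainder k e) (p : P) :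
    e p = if e p % k = 0 then 0 else k + e p % k := by
  rcases he p with h0 | ⟨h1, h2⟩
  · simp [h0]
  · have h3 : e p % k = e p - k := by
      rw [Nat.mod_eq_sub_mod h1.le, Nat.mod_eq_of_lt (by omega)]
    rw [if_neg (by omega)]
    omega

lemma nsmul_add_injective {k : ℕ} (hk : 1 ≤ k) {n n' e e' : FreeMonoidOn P}
    (he : IsRemainder k e) (he' : IsRemainder k e') (h : k • n + e = k • n' + e') :
    n = n' ∧ e = e' := by
  have hp : ∀ p, k * n p + e p = k * n' p + e' p := fun p => by
    simpa using DFunLike.congr_fun h p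
  have hee : e = e' := by
    ext p
    have h1 : e p % k = e' p % k := by
      have := congrArg (· % k) (hp p)
      simpa using this
    rw [he.eq_ite, he'.eq_ite, h1]
  subst hee
  refine ⟨?_, rfl⟩
  ext p
  exact Nat.eq_of_mul_eq_mul_left hk (Nat.add_right_cancel (hp p))

lemma isRemainder_zero (k : ℕ) : IsRemainder k (0 : FreeMonoidOn P) := fun _ => Or.inl rfl

/-- In the Euler product each factor is `1 + O(N(p)^(-1-1/k))`, with fewer than `k` nontrivial terms
of exponent at least `(k + 1)/k`; the sum over generators converges. -/
lemma Regular.summable_remainder (h : Regular N) {k : ℕ} (hk : 1 ≤ k) :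
    Summable fun e : {e : FreeMonoidOn P // IsRemainder k e} =>
      (monoidNorm N e.1 : ℝ) ^ (-(k : ℝ)⁻¹) := by
  classical
  have hk1 : (1 : ℝ) ≤ k := by exact_mod_cast hk
  have hk0 : (0 : ℝ) < k := by linarith
  obtain ⟨K, hK, hb⟩ := h.sum_gens_rpow_le (inv_pos.2 hk0) (inv_le_one_of_one_le₀ hk1)
  refine summable_of_sum_le (c := Real.exp (k * K)) (fun e => by positivity) fun u => ?_
  set v : Finset (FreeMonoidOn P) := u.map (Function.Embedding.subtype _)
  set T : Finset P := v.biUnion Finsupp.support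
  set J : Finset ℕ := insert 0 (Finset.Ioo k (2 * k))
  have hv : v ⊆ T.finsupp fun _ => J := by
    intro e he
    obtain ⟨e', he', rfl⟩ := Finset.mem_map.1 he
    refine Finset.mem_finsupp_iff.2 ⟨Finset.subset_biUnion_of_mem _ he, fun p _ => ?_⟩
    rw [Finset.mem_insert, Finset.mem_Ioo]
    exact e'.2 p
  calc ∑ e ∈ u, (monoidNorm N e.1 : ℝ) ^ (-(k : ℝ)⁻¹)
      = ∑ e ∈ v, (monoidNorm N e : ℝ) ^ (-(k : ℝ)⁻¹) := by rw [Finset.sum_map]; rfl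
    _ ≤ ∑ e ∈ T.finsupp fun _ => J, (monoidNorm N e : ℝ) ^ (-(k : ℝ)⁻¹) :=
        Finset.sum_le_sum_of_subset_of_nonneg hv fun _ _ _ => by positivity
    _ = ∑ e ∈ T.finsupp fun _ => J, ∏ p ∈ T, ((N p : ℝ) ^ (e p)) ^ (-(k : ℝ)⁻¹) :=
        Finset.sum_congr rfl fun e he => monoidNorm_rpow _ (Finset.mem_finsupp_iff.1 he).1
    _ = ∏ p ∈ T, ∑ j ∈ J, ((N p : ℝ) ^ j) ^ (-(k : ℝ)⁻¹) :=
        sum_finsupp_prod T (fun _ => J) fun p j => ((N p : ℝ) ^ j) ^ (-(k : ℝ)⁻¹)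
    _ ≤ ∏ p ∈ T, Real.exp (k * (N p : ℝ) ^ (-(1 + (k : ℝ)⁻¹))) := by
        refine Finset.prod_le_prod (fun p _ => Finset.sum_nonneg fun _ _ => by positivity)
          fun p _ => ?_
        have hNp : (1 : ℝ) ≤ N p := by exact_mod_cast (h.one_lt p).le
        rw [Finset.sum_insert (by simp), pow_zero, Real.one_rpow]
        have hj : ∀ j ∈ Finset.Ioo k (2 * k),
            ((N p : ℝ) ^ j) ^ (-(k : ℝ)⁻¹) ≤ (N p : ℝ) ^ (-(1 + (k : ℝ)⁻¹)) := by
          intro j hj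
          have hj1 : (k : ℝ) + 1 ≤ j := by exact_mod_cast (Finset.mem_Ioo.1 hj).1
          rw [← Real.rpow_natCast, ← Real.rpow_mul (by positivity)]
          refine Real.rpow_le_rpow_of_exponent_le hNp ?_
          rw [mul_neg, neg_le_neg_iff, ← div_eq_mul_inv, le_div_iff₀ hk0, add_mul,
            inv_mul_cancel₀ hk0.ne']
          linarith
        have h1 := Finset.sum_le_card_nsmul _ _ _ hj
        rw [Nat.card_Ioo, nsmul_eq_mul] at h1
        have h2 : ((2 * k - k - 1 : ℕ) : ℝ) ≤ k := by
          exact_mod_cast (by omega : 2 * k - k - 1 ≤ k)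
        have h3 : ((2 * k - k - 1 : ℕ) : ℝ) * (N p : ℝ) ^ (-(1 + (k : ℝ)⁻¹))
            ≤ k * (N p : ℝ) ^ (-(1 + (k : ℝ)⁻¹)) := by gcongr
        linarith [Real.add_one_le_exp (k * (N p : ℝ) ^ (-(1 + (k : ℝ)⁻¹)))]
    _ = Real.exp (k * ∑ p ∈ T, (N p : ℝ) ^ (-(1 + (k : ℝ)⁻¹))) := by
        rw [← Real.exp_sum, Finset.mul_sum]
    _ ≤ Real.exp (k * K) := by
        gcongr
        exact hb T

/-- The bound on the norm of `n` that corresponds to the bound `x` on the norm of `k • n + e`. -/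
noncomputable def rootBound (N : P → ℕ) (k : ℕ) (e : FreeMonoidOn P) (x : ℝ) : ℝ :=
  (x / monoidNorm N e) ^ (k : ℝ)⁻¹

lemma Regular.mem_below_rootBound (h : Regular N) {k : ℕ} (hk : 1 ≤ k) (n e : FreeMonoidOn P)
    {x : ℝ} (hx : 0 ≤ x) :
    n ∈ below N (rootBound N k e x) ↔ (monoidNorm N (k • n + e) : ℝ) ≤ x := by
  have he := one_le_monoidNorm h.one_lt e
  have hk0 : (0 : ℝ) < k := by exact_mod_cast hk
  rw [h.mem_below, rootBound, Real.le_rpow_inv_iff_of_pos (by positivity) (by positivity) hk0,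
    Real.rpow_natCast, le_div_iff₀ (by linarith), monoidNorm_add, monoidNorm_nsmul]
  push_cast
  rfl

lemma Regular.ncard_full (h : Regular N) {k : ℕ} (hk : 1 ≤ k) {x : ℚ} (hx : 0 ≤ x)
    (S : Finset {e : FreeMonoidOn P // IsRemainder k e})
    (hS : ∀ e, e ∈ S ↔ (monoidNorm N e.1 : ℝ) ≤ x) (C : FreeMonoidOn P → Prop)
    [DecidablePred C] :
    {m ∈ fullUpTo N k x | C m}.ncard
      = ∑ e ∈ S, ((below N (rootBound N k e.1 x)).filter fun n => C (k • n + e.1)).card := by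
  classical
  rw [← Finset.card_sigma, ← Set.ncard_coe_finset]
  have hx' : (0 : ℝ) ≤ x := by exact_mod_cast hx
  have himg : {m ∈ fullUpTo N k x | C m}
      = (fun z : (_ : {e : FreeMonoidOn P // IsRemainder k e}) × FreeMonoidOn P =>
          k • z.2 + z.1.1) '' (S.sigma fun e =>
            (below N (rootBound N k e.1 x)).filter fun n => C (k • n + e.1)) := by
    ext m
    simp only [fullUpTo, Set.mem_ofPred_eq, Set.mem_image, Finset.mem_coe, Finset.mem_sigma,
      Finset.mem_filter, h.mem_below_rootBound hk _ _ hx', hS]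
    constructor
    · rintro ⟨⟨hm, hmx⟩, hC⟩
      obtain ⟨n, e, he, rfl⟩ := exists_eq_nsmul_add hk hm
      have hmx' : (monoidNorm N (k • n + e) : ℝ) ≤ x := by exact_mod_cast hmx
      refine ⟨⟨⟨e, he⟩, n⟩, ⟨le_trans ?_ hmx', hmx', hC⟩, rfl⟩
      rw [monoidNorm_add]
      exact_mod_cast Nat.le_mul_of_pos_left _ (monoidNorm_pos h.one_lt _)
    · rintro ⟨⟨e, n⟩, ⟨-, hmx, hC⟩, rfl⟩
      exact ⟨⟨isFull_nsmul_add n e.2, by exact_mod_cast hmx⟩, hC⟩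
  rw [himg, Set.InjOn.ncard_image]
  rintro ⟨⟨e, he⟩, n⟩ - ⟨⟨e', he'⟩, n'⟩ - heq
  obtain ⟨rfl, rfl⟩ := nsmul_add_injective hk he he' heq
  rfl

lemma tendsto_rootBound (hN : ∀ p, 1 < N p) {k : ℕ} (hk : 1 ≤ k) (e : FreeMonoidOn P) :
    Tendsto (rootBound N k e) atTop atTop := by
  have he := one_le_monoidNorm hN e
  have hk0 : (0 : ℝ) < k := by exact_mod_cast hk
  exact (tendsto_rpow_atTop (inv_pos.2 hk0)).comp (tendsto_id.atTop_div_const (by linarith))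

/-- If a property has limiting density `φ` among the elements `k • n + e`, for each remainder `e`,
then it has limiting density `φ` among the `k`-full elements. -/
lemma Regular.tendsto_ncard_full_div (h : Regular N) {k : ℕ} (hk : 1 ≤ k)
    (C : FreeMonoidOn P → Prop) [DecidablePred C] {φ : ℝ}
    (hφ : ∀ e : FreeMonoidOn P, Tendsto (fun y => (((below N y).filter fun n =>
      C (k • n + e)).card : ℝ) / (below N y).card) atTop (𝓝 φ)) :
    Tendsto (fun x : ℚ => ({m ∈ fullUpTo N k x | C m}.ncard : ℝ) / (fullUpTo N k x).ncard)
      atTop (𝓝 φ) := by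
  classical
  obtain ⟨b, hb, hup⟩ := h.upper
  obtain ⟨c, hc, hlo⟩ := h.lower
  have hk0 : (0 : ℝ) < k := by exact_mod_cast hk
  set A : {e : FreeMonoidOn P // IsRemainder k e} → ℚ → ℝ := fun e x =>
    ((below N (rootBound N k e.1 x)).filter fun n => C (k • n + e.1)).card
  set B : {e : FreeMonoidOn P // IsRemainder k e} → ℚ → ℝ := fun e x =>
    (below N (rootBound N k e.1 x)).card
  -- The deviation on each fibre is normalised by `c x^(1/k)`, a lower bound for the number of
  -- `k`-full elements supplied by the fibre `e = 0` alone.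
  set f : ℚ → {e : FreeMonoidOn P // IsRemainder k e} → ℝ := fun x e =>
    |A e x - φ * B e x| / (c * (x : ℝ) ^ (k : ℝ)⁻¹)
  have hcast : Tendsto (fun x : ℚ => (x : ℝ)) atTop atTop := tendsto_ratCast_atTop_iff.2 tendsto_id
  have hAB : ∀ e x, A e x ≤ B e x := fun e x =>
    Nat.cast_le.2 (Finset.card_filter_le _ _)
  have hA0 : ∀ e x, 0 ≤ A e x := fun e x => Nat.cast_nonneg _
  have hB0 : ∀ e x, 0 ≤ B e x := fun e x => Nat.cast_nonneg _
  have hBup : ∀ e, ∀ x : ℚ, 1 ≤ x → B e x / (c * (x : ℝ) ^ (k : ℝ)⁻¹)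
      ≤ b / c * (monoidNorm N e.1 : ℝ) ^ (-(k : ℝ)⁻¹) := by
    intro e x hx
    have hx' : (1 : ℝ) ≤ x := by exact_mod_cast hx
    have hxp : 0 < (x : ℝ) ^ (k : ℝ)⁻¹ := by positivity
    have he := one_le_monoidNorm h.one_lt e.1
    have h1 : B e x ≤ b * rootBound N k e.1 x := hup _ (by unfold rootBound; positivity)
    have h2 : rootBound N k e.1 x
        = (x : ℝ) ^ (k : ℝ)⁻¹ * (monoidNorm N e.1 : ℝ) ^ (-(k : ℝ)⁻¹) := by
      rw [rootBound, Real.div_rpow (by linarith) (by linarith), Real.rpow_neg (by linarith),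
        div_eq_mul_inv]
    rw [div_le_iff₀ (by positivity)]
    refine h1.trans (le_of_eq ?_)
    rw [h2]
    field_simp
  have hf0 : Tendsto (fun x => ∑' e, f x e) atTop (𝓝 0) := by
    have hlim : ∀ e, Tendsto (fun x => f x e) atTop (𝓝 0) := by
      intro e
      have h1 := (hφ e.1).comp ((tendsto_rootBound h.one_lt hk e.1).comp hcast)
      rw [← tendsto_sub_nhds_zero_iff] at h1
      have h2 := h1.abs.mul_const (b / c * (monoidNorm N e.1 : ℝ) ^ (-(k : ℝ)⁻¹))
      rw [abs_zero, zero_mul] at h2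
      refine squeeze_zero' ?_ ?_ h2
      · filter_upwards [eventually_ge_atTop 1] with x hx
        have hx' : (1 : ℝ) ≤ x := by exact_mod_cast hx
        positivity
      · filter_upwards [eventually_ge_atTop 1] with x hx
        have hx' : (1 : ℝ) ≤ x := by exact_mod_cast hx
        -- An empty fibre needs separate treatment, since `A / B` is then 0 by convention; both
        -- sides vanish.
        have h3 : |A e x - φ * B e x| = |A e x / B e x - φ| * B e x := by
          rcases (hB0 e x).eq_or_lt' with h0 | h0
          · have : A e x = 0 := le_antisymm (h0 ▸ hAB e x) (hA0 e x)
            simp [h0, this]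
          · rw [← abs_of_pos h0, ← abs_mul, abs_of_pos h0, sub_mul, div_mul_cancel₀ _ h0.ne']
        simp only [f]
        rw [h3, mul_div_assoc]
        exact mul_le_mul_of_nonneg_left (hBup e x hx) (abs_nonneg _)
    have := tendsto_tsum_of_dominated_convergence (𝓕 := atTop) (f := f) (g := fun _ => 0)
      (((h.summable_remainder hk).mul_left (b / c)).mul_left (1 + |φ|)) hlim ?_
    · simpa using this
    · filter_upwards [eventually_ge_atTop 1] with x hx e
      have hx' : (1 : ℝ) ≤ x := by exact_mod_cast hx
      have h1 : |A e x - φ * B e x| ≤ (1 + |φ|) * B e x := by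
        refine (abs_sub _ _).trans ?_
        rw [abs_of_nonneg (hA0 e x), abs_mul, abs_of_nonneg (hB0 e x)]
        linarith [hAB e x]
      rw [Real.norm_of_nonneg (by positivity)]
      calc f x e ≤ (1 + |φ|) * B e x / (c * (x : ℝ) ^ (k : ℝ)⁻¹) := by
            simp only [f]
            gcongr
        _ = (1 + |φ|) * (B e x / (c * (x : ℝ) ^ (k : ℝ)⁻¹)) := mul_div_assoc _ _ _
        _ ≤ _ := by gcongr; exact hBup e x hx
  rw [← tendsto_sub_nhds_zero_iff]
  refine squeeze_zero_norm' ?_ hf0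
  filter_upwards [eventually_ge_atTop 1] with x hx
  have hx' : (1 : ℝ) ≤ x := by exact_mod_cast hx
  have hfin : {e : {e : FreeMonoidOn P // IsRemainder k e} | (monoidNorm N e.1 : ℝ) ≤ x}.Finite :=
    (h.finite x).preimage Subtype.val_injective.injOn
  set S := hfin.toFinset
  have hS : ∀ e, e ∈ S ↔ (monoidNorm N e.1 : ℝ) ≤ x := fun e => by simp [S]
  have eA : ({m ∈ fullUpTo N k x | C m}.ncard : ℝ) = ∑ e ∈ S, A e x := by
    rw [h.ncard_full hk (by linarith) S hS C]
    push_cast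
    rfl
  have eB : ((fullUpTo N k x).ncard : ℝ) = ∑ e ∈ S, B e x := by
    have := h.ncard_full hk (by linarith) S hS (fun _ => True)
    simp only [and_true, Set.ofPred_mem_eq, Finset.filter_true] at this
    rw [this]
    push_cast
    rfl
  have hD : c * (x : ℝ) ^ (k : ℝ)⁻¹ ≤ ∑ e ∈ S, B e x := by
    set e₀ : {e : FreeMonoidOn P // IsRemainder k e} := ⟨0, isRemainder_zero k⟩
    have h0 : e₀ ∈ S := by
      rw [hS]
      simpa [e₀, monoidNorm_zero] using hx'
    refine le_trans ?_ (Finset.single_le_sum (fun e _ => hB0 e x) h0)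
    have h1 : rootBound N k e₀.1 x = (x : ℝ) ^ (k : ℝ)⁻¹ := by
      simp [rootBound, e₀, monoidNorm_zero]
    have h2 := hlo (rootBound N k e₀.1 x) (by
      rw [h1]
      exact Real.one_le_rpow hx' (by positivity))
    refine le_trans (le_of_eq ?_) h2
    rw [h1]
  have hx0 : 0 < c * (x : ℝ) ^ (k : ℝ)⁻¹ := by positivity
  have hD0 : 0 < ∑ e ∈ S, B e x := hx0.trans_le hD
  have hsupp : ∑ e ∈ S, f x e ≤ ∑' e, f x e := by
    refine le_of_eq (tsum_eq_sum fun e he => ?_).symm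
    have hem : below N (rootBound N k e.1 x) = ∅ := by
      refine Finset.eq_empty_of_forall_notMem fun n hn => he ?_
      rw [h.mem_below_rootBound hk _ _ (by linarith)] at hn
      rw [hS]
      refine le_trans ?_ hn
      rw [monoidNorm_add]
      exact_mod_cast Nat.le_mul_of_pos_left _ (monoidNorm_pos h.one_lt _)
    simp [f, A, B, hem]
  rw [eA, eB]
  have e1 : (∑ e ∈ S, A e x) / (∑ e ∈ S, B e x) - φ
      = (∑ e ∈ S, (A e x - φ * B e x)) / ∑ e ∈ S, B e x := by
    rw [Finset.sum_sub_distrib, ← Finset.mul_sum]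
    field_simp
  rw [e1, Real.norm_eq_abs, abs_div, abs_of_pos hD0]
  calc _ ≤ (∑ e ∈ S, |A e x - φ * B e x|) / (c * (x : ℝ) ^ (k : ℝ)⁻¹) := by
        gcongr
        exact Finset.abs_sum_le_sum_abs _ _
    _ = ∑ e ∈ S, f x e := by rw [Finset.sum_div]
    _ ≤ _ := hsupp

end Decomposition

end ErdosKacMonoid

theorem theorem1p6 {P : Type*} [Countable P] (N : P → ℕ) (hN : ∀ p, 1 < N p)
    (X : Set ℚ) (hX : ErdosKacMonoid.IsScale X)
    (hNX : ∀ m : ErdosKacMonoid.FreeMonoidOn P, (ErdosKacMonoid.monoidNorm N m : ℚ) ∈ X)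
    (hcount : ErdosKacMonoid.CountingCondition N X) (k : ℕ) (hk : 1 ≤ k) (a : ℝ) :
    Tendsto
      (fun x : ℚ =>
        ({m ∈ ErdosKacMonoid.fullUpTo N k x | 3 ≤ ErdosKacMonoid.monoidNorm N m ∧
            ((ErdosKacMonoid.omegaExact k m : ℝ)
                - Real.log (Real.log (ErdosKacMonoid.monoidNorm N m)))
              / Real.sqrt (Real.log (Real.log (ErdosKacMonoid.monoidNorm N m))) ≤ a}.ncard : ℝ)
          / ((ErdosKacMonoid.fullUpTo N k x).ncard : ℝ))
      (ErdosKacMonoid.atTopIn X) (𝓝 (ErdosKacMonoid.Phi a)) := by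
  have h := hcount.regular hN hX hNX
  -- Regularity no longer mentions `X`, so the limit holds along all rationals and is only
  -- restricted to `X` at the end.
  exact (h.tendsto_ncard_full_div hk (fun m => 3 ≤ ErdosKacMonoid.monoidNorm N m ∧
    ((ErdosKacMonoid.omegaExact k m : ℝ)
        - Real.log (Real.log (ErdosKacMonoid.monoidNorm N m)))
      / Real.sqrt (Real.log (Real.log (ErdosKacMonoid.monoidNorm N m))) ≤ a)
    fun e => h.tendsto_card_component hk e a).mono_left inf_le_left
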